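/- **The random graph.** For real $\delta\ge 0$, $\mathrm{PA}_1(1,\delta)$ is a single vertex with one loop. Given $\mathrm{PA}_n(1,\delta)$, the graph $\mathrm{PA}_{n+1}(1,\delta)$ is obtained by adding a vertex $n+1$ with one edge, whose other end is $n+1$ itself with probability $\frac{1+\delta}{n(2+\delta)+(1+\delta)}$ and is $i\in\{1,\dots,n\}$ with probability $\frac{D_i(n)+\delta}{n(2+\delta)+(1+\delta)}$, where $D_i(n)$ is the degree of $i$ in $\mathrm{PA}_n(1,\delta)$ (loops count twice). For $m\ge 1$, $\mathrm{PA}_t(m,\delta)$ is the multigraph on $\{1,\dots,t\}$ obtained from $\mathrm{PA}_{mt}(1,\delta/m)$ by contracting, for each $i=1,\dots,t$, the vertices $(i-1)m+1,\dots,im$ into the vertex $i$, keeping all loops and multiple edges. **The protocol.** Let $k$ be odd. In the $k$-choice local majority protocol $\mathcal{MP}^k$ on a multigraph whose vertices are coloured red or blue at time $0$, at each time step $\tau=1,2,\dots$ each vertex $v$, independently of everything else, chooses uniformly at random a set of $k$ of its neighbours, counted with multiplicity (that is, a set of $k$ of the half-edges at $v$, a loop giving two half-edges); if the degree of $v$ is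 less than $k$, it chooses uniformly at random such a set of the largest possible odd cardinality. The colour of $v$ at time $\tau$ is the majority colour, at time $\tau-1$, of the chosen neighbours. **Theorem.** Let $k\ge 5$ be odd, let $m\ge 5$, and let $d=\min(m,k)$ if $m$ is odd and $d=\min(m-1,k)$ if $m$ is even. Let $\alpha^*$ be the smallest positive solution $x\in(0,1]$ of the equation $$\Pr\Big(\mathrm{Bin}(d-1,x)\ge \tfrac{d-1}{2}\Big)=x .$$ Let $\delta\ge 0$ and $0\le\alpha<\alpha^*$, and suppose that, given $\mathrm{PA}_t(m,\delta)$, each of its vertices is coloured red at time $0$ independently with probability $\alpha$, and blue otherwise. Then for every constant $\varepsilon>0$, with probability tending to $1$ as $t\to\infty$ (with $m,k,\delta,\alpha,\varepsilon$ fixed), under $\mathcal{MP}^k$ every vertex of $\mathrm{PA}_t(m,\delta)$ is blue at all time steps $$\tau\ \ge\ \frac{1+\varepsilon}{\log_d\big(\frac{d-1}{2}\big)}\,\log_d\log_d t .$$ -/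

import Mathlib

open MeasureTheory ProbabilityTheory Filter Topology
open scoped NNReal ENNReal

namespace PrefAttach

/-! ### Finite multigraphs -/

/-- A multigraph with vertex set `V` and edge set `E`; loops and parallel edges are allowed.
The edge `e` consists of the two half-edges `(e, false)` and `(e, true)`, and `G.ends e b` is the
vertex at which the half-edge `(e, b)` sits. -/
structure Multigraph (V E : Type) where
  ends : E → Bool → V

namespace Multigraph

variable {V W E : Type}

/-- The vertex at which a half-edge sits. -/
def base (G : Multigraph V E) (h : E × Bool) : V := G.ends h.1 h.2

/-- The vertex at the other end of the edge to which a half-edge belongs. -/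
def opposite (G : Multigraph V E) (h : E × Bool) : V := G.ends h.1 (!h.2)

/-- The image of a multigraph under a map of vertices; all loops and parallel edges that this
creates are kept. -/
def contract (G : Multigraph V E) (f : V → W) : Multigraph W E where
  ends e b := f (G.ends e b)

/-- The half-edges that sit at `v`; a loop at `v` contributes both of its half-edges. -/
def halfEdges [Fintype E] [DecidableEq V] (G : Multigraph V E) (v : V) : Finset (E × Bool) :=
  Finset.univ.filter fun h => G.base h = v

/-- The degree of `v`; loops count twice. -/
def degree [Fintype E] [DecidableEq V] (G : Multigraph V E) (v : V) : ℕ :=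
  (G.halfEdges v).card

lemma sum_degree [Fintype V] [Fintype E] [DecidableEq V] (G : Multigraph V E) :
    ∑ v, G.degree v = 2 * Fintype.card E := by
  have h := Finset.card_eq_sum_card_fiberwise (s := (Finset.univ : Finset (E × Bool)))
    (t := (Finset.univ : Finset V)) (f := G.base) (fun _ _ => by simp)
  simp only [degree, halfEdges]
  rw [← h, Finset.card_univ, Fintype.card_prod, Fintype.card_bool, mul_comm]

end Multigraph

/-! ### Preferential attachment -/

/-- The possible outcomes of `PA_n(1, δ)`, with vertices numbered from `0`: vertex `i` has one edge
of its own, whose other end is one of the vertices `0, …, i`. -/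
abbrev Attachments (n : ℕ) : Type := (i : Fin n) → Fin ((i : ℕ) + 1)

/-- The graph in which the edge `i` joins the vertex `i` to the vertex `g i`. -/
def attachmentGraph {n : ℕ} (g : Attachments n) : Multigraph (Fin n) (Fin n) where
  ends i b := if b then ⟨g i, by have := (g i).isLt; have := i.isLt; omega⟩ else i

/-- `g` followed by the choice `x` of the vertex `n`. -/
def Attachments.extend {n : ℕ} (g : Attachments n) (x : Fin (n + 1)) : Attachments (n + 1) :=
  Fin.snoc (α := fun i : Fin (n + 1) => Fin ((i : ℕ) + 1)) g x

/-- The probability that the edge of the new vertex `n` connects to `i`, given the graph on the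
vertices `0, …, n - 1`: it is `(1 + δ) / (n (2 + δ) + (1 + δ))` for the new vertex itself and
`(D_i(n) + δ) / (n (2 + δ) + (1 + δ))` for an old vertex `i`. -/
noncomputable def stepProb (δ : ℝ≥0) {n : ℕ} (g : Attachments n) (i : Fin (n + 1)) : ℝ≥0 :=
  Fin.lastCases (motive := fun _ => ℝ≥0)
    ((1 + δ) / (n * (2 + δ) + (1 + δ)))
    (fun j => ((attachmentGraph g).degree j + δ) / (n * (2 + δ) + (1 + δ))) i

lemma sum_stepProb (δ : ℝ≥0) {n : ℕ} (g : Attachments n) : ∑ i, stepProb δ g i = 1 := by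
  have h : ∑ j, (((attachmentGraph g).degree j : ℕ) : ℝ≥0) = 2 * n := by
    have := (attachmentGraph g).sum_degree
    rw [Fintype.card_fin] at this
    exact_mod_cast this
  rw [Fin.sum_univ_castSucc]
  simp only [stepProb, Fin.lastCases_castSucc, Fin.lastCases_last]
  rw [← Finset.sum_div, ← add_div, Finset.sum_add_distrib, h]
  simp only [Finset.sum_const, Finset.card_univ, Fintype.card_fin, nsmul_eq_mul]
  rw [div_eq_one_iff_eq (by positivity)]
  ring

/-- The law of the end of the edge of the new vertex. -/
noncomputable def stepLaw (δ : ℝ≥0) {n : ℕ} (g : Attachments n) : PMF (Fin (n + 1)) :=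
  PMF.ofFintype (fun i => (stepProb δ g i : ℝ≥0∞)) (by
    rw [← ENNReal.ofNNReal_finsetSum, sum_stepProb, ENNReal.coe_one])

/-- The law of `PA_n(1, δ)`. The growth rule applied to the empty graph produces the vertex `0` with
a loop, with probability one, so that `PA_1(1, δ)` is a single vertex with a loop. -/
noncomputable def attachmentLaw (δ : ℝ≥0) : (n : ℕ) → PMF (Attachments n)
  | 0 => PMF.pure fun i => i.elim0
  | n + 1 => (attachmentLaw δ n).bind fun g => (stepLaw δ g).map g.extend

/-- The graph obtained from an outcome of `PA_{tm}(1, ·)` by contracting, for each `i < t`, the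
vertices `i m, …, i m + m - 1` into the vertex `i`. If the outcome has the law
`attachmentLaw (δ / m) (t * m)`, then this is the random graph `PA_t(m, δ)`. -/
def paGraph (m t : ℕ) (g : Attachments (t * m)) : Multigraph (Fin t) (Fin (t * m)) :=
  (attachmentGraph g).contract Fin.divNat

/-! ### The `k`-choice local majority protocol -/

inductive Colour
  | red
  | blue
  deriving DecidableEq

instance : MeasurableSpace Colour := ⊤

section Protocol

variable {V E : Type} [Fintype V] [DecidableEq V] [Fintype E]

/-- The number of neighbours that a vertex of degree `D` polls: `k` if `k ≤ D`, and otherwise the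
largest odd number that is at most `D` (or none if `D = 0`). -/
def pollSize (k D : ℕ) : ℕ :=
  if k ≤ D then k else if Odd D then D else D - 1

lemma pollSize_le (k D : ℕ) : pollSize k D ≤ D := by
  unfold pollSize
  split_ifs <;> omega

/-- The law of one poll of `v`: a set of half-edges at `v` of the prescribed size, chosen uniformly
at random. Thus neighbours are counted with multiplicity. -/
noncomputable def pollLaw (G : Multigraph V E) (k : ℕ) (v : V) : PMF (Finset (E × Bool)) :=
  PMF.uniformOfFinset ((G.halfEdges v).powersetCard (pollSize k (G.degree v)))
    (Finset.powersetCard_nonempty.2 (pollSize_le k (G.degree v)))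

/-- The colours at time `τ`, given the initial colours `c` and the polls; `polls (τ, v)` is the
poll of `v` that determines its colour at time `τ + 1`. -/
def colourAt (G : Multigraph V E) (c : V → Colour) (polls : ℕ × V → Finset (E × Bool)) :
    ℕ → V → Colour
  | 0 => c
  | τ + 1 => fun v =>
      if (polls (τ, v)).card <
          2 * ((polls (τ, v)).filter fun h => colourAt G c polls τ (G.opposite h) = .red).card
      then .red else .blue

/-- The joint law of the initial colours and of all polls, on a fixed multigraph: all of these are
independent, and every vertex is initially red with probability `α`. -/
noncomputable def protocolLaw (G : Multigraph V E) (k : ℕ) (α : unitInterval) :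
    Measure ((V → Colour) × (ℕ × V → Finset (E × Bool))) :=
  (Measure.pi fun _ : V => bernoulliMeasure Colour.red Colour.blue α).prod
    (Measure.infinitePi fun i : ℕ × V => (pollLaw G k i.2).toMeasure)

instance (G : Multigraph V E) (k : ℕ) (α : unitInterval) :
    IsProbabilityMeasure (protocolLaw G k α) := by
  unfold protocolLaw
  infer_instance

end Protocol

/-! ### The protocol on the preferential attachment graph -/

/-- An outcome of the whole experiment: the random graph, the initial colours and the polls. -/
abbrev Outcome (m t : ℕ) : Type :=
  Attachments (t * m) × (Fin t → Colour) × (ℕ × Fin t → Finset (Fin (t * m) × Bool))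

/-- The law of the experiment: first `PA_t(m, δ)` is generated, and then, given the graph, the
protocol is run with initial density `α` of red vertices. -/
noncomputable def experimentLaw (m : ℕ) (δ : ℝ≥0) (k : ℕ) (α : unitInterval) (t : ℕ) :
    Measure (Outcome m t) :=
  (attachmentLaw (δ / m) (t * m)).toMeasure ⊗ₘ
    Kernel.ofFunOfCountable fun g => protocolLaw (paGraph m t g) k α

instance (m : ℕ) (δ : ℝ≥0) (k : ℕ) (α : unitInterval) (t : ℕ) :
    IsProbabilityMeasure (experimentLaw m δ k α t) := by
  have : IsMarkovKernel (Kernel.ofFunOfCountable fun g : Attachments (t * m) =>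
      protocolLaw (paGraph m t g) k α) :=
    ⟨fun g => inferInstanceAs (IsProbabilityMeasure (protocolLaw (paGraph m t g) k α))⟩
  unfold experimentLaw
  infer_instance

/-- The colour of the vertex `v` at time `τ` in a given outcome. -/
def Outcome.colour {m t : ℕ} (ω : Outcome m t) (τ : ℕ) (v : Fin t) : Colour :=
  colourAt (paGraph m t ω.1) ω.2.1 ω.2.2 τ v

end PrefAttach

/-!
Call a half-edge tangled if the edges within the relevant distance behind it contain a cycle. As
long as no poll hits a tangled half-edge, the branches behind the half-edges at a vertex behave
independently, and the probability that the far end of an untangled half-edge is red, even if that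
end regards the vertex in front of it as red, is at most the iterate at `α` of the map
`x ↦ P(Bin(2r, x) ≥ r)`, where `d = 2r + 1`. Below its least positive fixed point `α*` these
iterates decay doubly exponentially, as `exp (-r ^ i)`, which falls below `t ^ (-2)` after
`log_r (2 log t)` steps.

A vertex with at most two tangled half-edges is harmless, since a majority of at least five polls
contains three red ones. A vertex with more lies on a subgraph with more edges than vertices. A
first moment bound, which rests on the upper bounds for the degrees, shows that with high
probability only the first `t ^ (4η)` vertices can be of this kind, and that these have altogether
few tangled half-edges. Their degrees are so large that with high probability they never poll a
tangled half-edge. Finally, once all vertices are blue they remain so.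
-/

namespace PrefAttach

/-! ### Tails of the binomial distribution -/

/-- The tail probability `P(Bin(n, x) ≥ k)`, defined by the recursion on the outcome of the first
trial, so that it makes sense for every real `x`. -/
noncomputable def binTail : ℕ → ℕ → ℝ → ℝ
  | _, 0, _ => 1
  | 0, _ + 1, _ => 0
  | n + 1, k + 1, x => x * binTail n k x + (1 - x) * binTail n (k + 1) x

@[simp] lemma binTail_zero_right (n : ℕ) (x : ℝ) : binTail n 0 x = 1 := by
  cases n <;> rfl

@[simp] lemma binTail_zero_succ (k : ℕ) (x : ℝ) : binTail 0 (k + 1) x = 0 := rfl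

lemma binTail_succ_succ (n k : ℕ) (x : ℝ) :
    binTail (n + 1) (k + 1) x = x * binTail n k x + (1 - x) * binTail n (k + 1) x := rfl

lemma binTail_eq_zero_of_lt {n k : ℕ} (h : n < k) (x : ℝ) : binTail n k x = 0 := by
  induction n generalizing k with
  | zero => cases k with
    | zero => omega
    | succ k => rfl
  | succ n ih => cases k with
    | zero => omega
    | succ k => rw [binTail_succ_succ, ih (by omega), ih (by omega)]; ring

lemma binTail_sub_binTail_succ (n k : ℕ) (x : ℝ) :
    binTail n k x - binTail n (k + 1) x = n.choose k * x ^ k * (1 - x) ^ (n - k) := by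
  induction n generalizing k with
  | zero => cases k <;> simp
  | succ n ih =>
    cases k with
    | zero =>
      have h := ih 0
      simp only [binTail_succ_succ, binTail_zero_right, Nat.choose_zero_right, pow_zero,
        Nat.sub_zero, pow_succ] at h ⊢
      linear_combination (1 - x) * h
    | succ k =>
      have hpow : (n.choose (k + 1) : ℝ) * (1 - x) ^ (n - k) =
          n.choose (k + 1) * ((1 - x) * (1 - x) ^ (n - (k + 1))) := by
        rcases lt_or_ge k n with hk | hk
        · rw [← pow_succ', show n - (k + 1) + 1 = n - k by omega]
        · simp [Nat.choose_eq_zero_of_lt (show n < k + 1 by omega)]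
      rw [binTail_succ_succ, binTail_succ_succ, Nat.choose_succ_succ, Nat.succ_sub_succ]
      push_cast
      linear_combination x * ih k + (1 - x) * ih (k + 1) - x ^ (k + 1) * hpow

lemma binomial_real_setOf_le (n k : ℕ) (p : unitInterval) :
    (binomial n p).real {j : ℕ | k ≤ j} = binTail n k p := by
  induction k with
  | zero => simp
  | succ k ih =>
    have hsplit : {j : ℕ | k ≤ j} = {k} ∪ {j : ℕ | k + 1 ≤ j} := by
      ext j
      simp only [Set.mem_ofPred_eq, Set.singleton_union, Set.mem_insert_iff]
      omega
    rw [hsplit, measureReal_union (by simp) (by measurability), binomial_real_singleton] at ih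
    linarith [binTail_sub_binTail_succ n k p]

lemma continuous_binTail (n k : ℕ) : Continuous (binTail n k) := by
  induction n generalizing k with
  | zero => cases k <;> exact continuous_const
  | succ n ih => cases k with
    | zero => exact continuous_const
    | succ k =>
      have := ih k
      have := ih (k + 1)
      change Continuous fun x => x * binTail n k x + (1 - x) * binTail n (k + 1) x
      fun_prop

section Bounds

variable {x : ℝ} (h0 : 0 ≤ x) (h1 : x ≤ 1)
include h0 h1

lemma binTail_succ_le (n k : ℕ) : binTail n (k + 1) x ≤ binTail n k x := by
  have : 0 ≤ 1 - x := sub_nonneg.2 h1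
  rw [← sub_nonneg, binTail_sub_binTail_succ]
  positivity

lemma binTail_succ_succ_le (n k : ℕ) : binTail (n + 1) (k + 1) x ≤ binTail n k x := by
  have := binTail_succ_le h0 h1 n k
  rw [binTail_succ_succ]
  nlinarith

lemma binTail_nonneg (n k : ℕ) : 0 ≤ binTail n k x := by
  have : 0 ≤ 1 - x := sub_nonneg.2 h1
  induction n generalizing k with
  | zero => cases k <;> simp
  | succ n ih => cases k with
    | zero => simp
    | succ k =>
      have := ih k
      have := ih (k + 1)
      rw [binTail_succ_succ]
      positivity

lemma binTail_le_two_pow_mul_pow (n k : ℕ) : binTail n k x ≤ 2 ^ n * x ^ k := by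
  induction n generalizing k with
  | zero => cases k with
    | zero => simp
    | succ k => rw [binTail_zero_succ]; positivity
  | succ n ih => cases k with
    | zero => simpa using one_le_pow₀ (M₀ := ℝ) (n := n + 1) one_le_two
    | succ k =>
      calc x * binTail n k x + (1 - x) * binTail n (k + 1) x
          ≤ x * (2 ^ n * x ^ k) + 1 * (2 ^ n * x ^ (k + 1)) :=
            add_le_add (mul_le_mul_of_nonneg_left (ih k) h0)
              (mul_le_mul (by linarith) (ih _) (binTail_nonneg h0 h1 _ _) zero_le_one)
        _ = 2 ^ (n + 1) * x ^ (k + 1) := by ring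

end Bounds

lemma binTail_add_binTail_one_sub {n k : ℕ} (hk : k ≤ n + 1) (x : ℝ) :
    binTail n k x + binTail n (n + 1 - k) (1 - x) = 1 := by
  induction n generalizing k with
  | zero => interval_cases k <;> simp
  | succ n ih => cases k with
    | zero => simp [binTail_eq_zero_of_lt]
    | succ k =>
      rcases Nat.lt_or_ge k (n + 1) with h | h
      · have ih₁ := ih (k := k) (by omega)
        have ih₂ := ih (k := k + 1) (by omega)
        rw [show n + 1 - k = n - k + 1 by omega] at ih₁
        rw [show n + 1 - (k + 1) = n - k by omega] at ih₂
        rw [show n + 1 + 1 - (k + 1) = n - k + 1 by omega, binTail_succ_succ, binTail_succ_succ]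
        linear_combination x * ih₁ + (1 - x) * ih₂
      · obtain rfl : k = n + 1 := by omega
        simp [binTail_eq_zero_of_lt]

lemma binTail_add_two_sub (n k : ℕ) (x : ℝ) :
    binTail (n + 2) (k + 2) x - binTail n (k + 1) x =
      x ^ 2 * (binTail n k x - binTail n (k + 1) x) -
        (1 - x) ^ 2 * (binTail n (k + 1) x - binTail n (k + 2) x) := by
  rw [binTail_succ_succ, binTail_succ_succ, binTail_succ_succ]
  ring

/-! ### The majority map and its iterates -/

/-- The map `x ↦ P(Bin(2r, x) ≥ r)`. It gives the probability that a vertex which polls `2r + 1`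
neighbours turns red, if one of these is red and the others are red independently with probability
`x`. -/
noncomputable def majorityMap (r : ℕ) (x : ℝ) : ℝ := binTail (2 * r) r x

/-- The positive fixed points in `(0, 1]` of the majority map; `α*` is the least of them. -/
def majorityFixedPoints (r : ℕ) : Set ℝ :=
  {x | 0 < x ∧ x ≤ 1 ∧ Function.IsFixedPt (majorityMap r) x}

lemma continuous_majorityMap (r : ℕ) : Continuous (majorityMap r) := continuous_binTail _ _

lemma majorityMap_nonneg (r : ℕ) {x : ℝ} (h0 : 0 ≤ x) (h1 : x ≤ 1) : 0 ≤ majorityMap r x :=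
  binTail_nonneg h0 h1 _ _

lemma majorityMap_le_pow (r : ℕ) {x : ℝ} (h0 : 0 ≤ x) (h1 : x ≤ 1) :
    majorityMap r x ≤ (4 * x) ^ r := by
  have h := binTail_le_two_pow_mul_pow h0 h1 (2 * r) r
  rwa [pow_mul, ← mul_pow, show (2 : ℝ) ^ 2 = 4 by norm_num] at h

lemma half_le_majorityMap_half (r : ℕ) : 1 / 2 ≤ majorityMap r (1 / 2) := by
  have hsymm := binTail_add_binTail_one_sub (show r ≤ 2 * r + 1 by omega) (1 / 2)
  rw [show 2 * r + 1 - r = r + 1 by omega, show (1 : ℝ) - 1 / 2 = 1 / 2 by norm_num] at hsymm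
  have hmono := binTail_succ_le (x := 1 / 2) (by norm_num) (by norm_num) (2 * r) r
  unfold majorityMap
  linarith

lemma majorityMap_succ_le {x : ℝ} (h0 : 0 ≤ x) (h1 : x ≤ 1 / 2) {r : ℕ} (hr : 1 ≤ r) :
    majorityMap (r + 1) x ≤ majorityMap r x := by
  obtain ⟨a, rfl⟩ := Nat.exists_eq_add_of_le' hr
  have hx : 0 ≤ 1 - x := by linarith
  have hchoose : ((2 * (a + 1)).choose a : ℝ) ≤ (2 * (a + 1)).choose (a + 1) := by
    exact_mod_cast Nat.choose_le_centralBinom a (a + 1)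
  rw [← sub_nonpos, majorityMap, majorityMap, show 2 * (a + 1 + 1) = 2 * (a + 1) + 2 by ring,
    binTail_add_two_sub, sub_nonpos, binTail_sub_binTail_succ, binTail_sub_binTail_succ,
    show 2 * (a + 1) - a = a + 2 by omega, show 2 * (a + 1) - (a + 1) = a + 1 by omega]
  calc x ^ 2 * (((2 * (a + 1)).choose a : ℝ) * x ^ a * (1 - x) ^ (a + 2))
      = x ^ (a + 1) * (1 - x) ^ (a + 2) * (x * (2 * (a + 1)).choose a) := by ring
    _ ≤ x ^ (a + 1) * (1 - x) ^ (a + 2) * ((1 - x) * (2 * (a + 1)).choose (a + 1)) := by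
        gcongr
        linarith
    _ = (1 - x) ^ 2 * (((2 * (a + 1)).choose (a + 1) : ℝ) * x ^ (a + 1) * (1 - x) ^ (a + 1)) := by
        ring

lemma majorityMap_anti {x : ℝ} (h0 : 0 ≤ x) (h1 : x ≤ 1 / 2) {r s : ℕ} (hr : 1 ≤ r)
    (hrs : r ≤ s) : majorityMap s x ≤ majorityMap r x := by
  induction s, hrs using Nat.le_induction with
  | base => rfl
  | succ s hs ih => exact (majorityMap_succ_le h0 h1 (hr.trans hs)).trans ih

section FixedPoint

variable {r : ℕ} (hr : 2 ≤ r)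
include hr

lemma majorityMap_lt_self_of_small {x : ℝ} (h0 : 0 < x) (h1 : 16 * x < 1) :
    majorityMap r x < x := by
  have hle := majorityMap_le_pow r h0.le (by linarith)
  have hpow : (4 * x) ^ r ≤ (4 * x) ^ 2 := pow_le_pow_of_le_one (by linarith) (by linarith) hr
  nlinarith

lemma exists_majorityFixedPoints_le {x : ℝ} (h0 : 0 < x) (h1 : x ≤ 1) (h : x ≤ majorityMap r x) :
    ∃ y ∈ majorityFixedPoints r, y ≤ x := by
  set u := min x (1 / 32)
  have hu0 : 0 < u := lt_min h0 (by norm_num)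
  have hu : majorityMap r u < u :=
    majorityMap_lt_self_of_small hr hu0 (by linarith [min_le_right x (1 / 32)])
  have hcont : ContinuousOn (fun y => majorityMap r y - y) (Set.Icc u x) :=
    ((continuous_majorityMap r).sub continuous_id).continuousOn
  obtain ⟨y, hy, hy0⟩ := intermediate_value_Icc (min_le_left _ _) hcont
    (show (0 : ℝ) ∈ Set.Icc _ _ from ⟨by linarith, by linarith⟩)
  exact ⟨y, ⟨hu0.trans_le hy.1, hy.2.trans h1, sub_eq_zero.1 hy0⟩, hy.2⟩

variable {a : ℝ} (ha : a ∈ lowerBounds (majorityFixedPoints r))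
include ha

lemma le_half_of_mem_lowerBounds : a ≤ 1 / 2 := by
  obtain ⟨y, hy, hy'⟩ := exists_majorityFixedPoints_le hr (x := 1 / 2) (by norm_num) (by norm_num)
    (half_le_majorityMap_half r)
  exact (ha hy).trans hy'

lemma majorityMap_lt_self {x : ℝ} (h0 : 0 < x) (h1 : x < a) : majorityMap r x < x := by
  by_contra! h
  obtain ⟨y, hy, hyx⟩ := exists_majorityFixedPoints_le hr h0
    (by linarith [le_half_of_mem_lowerBounds hr ha]) h
  exact ((ha hy).trans hyx).not_gt h1

lemma majorityMap_le_self {x : ℝ} (hx : x ∈ Set.Ico 0 a) : majorityMap r x ≤ x := by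
  rcases hx.1.eq_or_lt with rfl | h0
  · exact (majorityMap_le_pow r le_rfl zero_le_one).trans_eq (by simp [show r ≠ 0 by omega])
  · exact (majorityMap_lt_self hr ha h0 hx.2).le

variable {α : ℝ} (hα : α ∈ Set.Ico 0 a)
include hα

lemma iterate_majorityMap_mem_Ico (j : ℕ) : (majorityMap r)^[j] α ∈ Set.Ico 0 a := by
  induction j with
  | zero => exact hα
  | succ j ih =>
    rw [Function.iterate_succ_apply']
    have := le_half_of_mem_lowerBounds hr ha
    exact ⟨majorityMap_nonneg r ih.1 (by linarith [ih.2]),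
      (majorityMap_le_self hr ha ih).trans_lt ih.2⟩

lemma tendsto_iterate_majorityMap : Tendsto (fun j => (majorityMap r)^[j] α) atTop (𝓝 0) := by
  have hmem := iterate_majorityMap_mem_Ico hr ha hα
  have hanti : Antitone fun j => (majorityMap r)^[j] α := antitone_nat_of_succ_le fun j => by
    rw [Function.iterate_succ_apply']
    exact majorityMap_le_self hr ha (hmem j)
  have hlim := tendsto_atTop_ciInf hanti ⟨0, by rintro _ ⟨j, rfl⟩; exact (hmem j).1⟩
  set l := ⨅ j, (majorityMap r)^[j] α
  have hla : l < a := (hanti.le_of_tendsto hlim 0).trans_lt hα.2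
  have hfix : majorityMap r l = l :=
    isFixedPt_of_tendsto_iterate hlim (continuous_majorityMap r).continuousAt
  rcases (ge_of_tendsto' hlim fun j => (hmem j).1).eq_or_lt with h | h
  · rwa [← h] at hlim
  · exact absurd hfix (majorityMap_lt_self hr ha h hla).ne

lemma exists_iterate_majorityMap_le_exp :
    ∃ h : ℕ, ∀ i : ℕ, (majorityMap r)^[h + i] α ≤ Real.exp (-(r : ℝ) ^ i) := by
  have hmem := iterate_majorityMap_mem_Ico hr ha hα
  have hhalf := le_half_of_mem_lowerBounds hr ha
  obtain ⟨h, hh⟩ := ((tendsto_iterate_majorityMap hr ha hα).eventually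
    (gt_mem_nhds (show (0 : ℝ) < Real.exp (-1) / 16 by positivity))).exists
  refine ⟨h, fun i => ?_⟩
  -- The factor `16` makes the bound stable under iteration, since `16 * 4 ^ r ≤ 16 ^ r`.
  suffices 16 * (majorityMap r)^[h + i] α ≤ Real.exp (-(r : ℝ) ^ i) by linarith [(hmem (h + i)).1]
  induction i with
  | zero => simp only [add_zero, pow_zero]; linarith
  | succ i ih =>
    rw [← add_assoc, Function.iterate_succ_apply']
    obtain ⟨hx0, hxa⟩ := hmem (h + i)
    set x := (majorityMap r)^[h + i] α
    calc 16 * majorityMap r x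
        ≤ 4 ^ 2 * (4 * x) ^ r := by linarith [majorityMap_le_pow r hx0 (by linarith)]
      _ ≤ 4 ^ r * (4 * x) ^ r := by gcongr; norm_num
      _ = (16 * x) ^ r := by rw [← mul_pow]; ring
      _ ≤ Real.exp (-(r : ℝ) ^ i) ^ r := by gcongr
      _ = Real.exp (-(r : ℝ) ^ (i + 1)) := by rw [← Real.exp_nat_mul]; ring_nf

end FixedPoint

/-! ### Half-edges whose surroundings contain a cycle -/

namespace Multigraph

variable {V E : Type}

/-- The other half of the edge of a half-edge. -/
def rev (h : E × Bool) : E × Bool := (h.1, !h.2)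

lemma fst_rev (h : E × Bool) : (rev h).1 = h.1 := rfl

lemma base_rev (G : Multigraph V E) (h : E × Bool) : G.base (rev h) = G.opposite h := rfl

lemma base_eq_of_fst_eq {G : Multigraph V E} {g h : E × Bool} (hgh : g.1 = h.1) :
    G.base g = G.base h ∨ G.base g = G.opposite h := by
  obtain ⟨e, b⟩ := g
  obtain ⟨e, b'⟩ := h
  obtain rfl : _ = e := hgh
  cases b <;> cases b' <;> simp [base, opposite]

variable [DecidableEq V]

/-- The degree of `y` in the subgraph that consists of the edges in `F`; loops count twice. -/
def degIn (G : Multigraph V E) (F : Finset E) (y : V) : ℕ :=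
  ((F ×ˢ Finset.univ).filter fun h => G.base h = y).card

variable {G : Multigraph V E} {F F' : Finset E} {g h h' h'' : E × Bool} {v y z : V} {ℓ j : ℕ}

lemma card_le_degIn {S : Finset (E × Bool)} (hS : ∀ h ∈ S, h.1 ∈ F ∧ G.base h = y) :
    S.card ≤ G.degIn F y :=
  Finset.card_le_card fun h hh => by simpa using hS h hh

lemma degIn_mono (hF : F ⊆ F') (y : V) : G.degIn F y ≤ G.degIn F' y :=
  Finset.card_le_card (Finset.filter_subset_filter _ (Finset.product_subset_product_left hF))

/-- The edge of `h` lies in a set of at most `ℓ` edges that has no leaf except possibly at the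
vertex of `h`. If `h` is not tangled, then the part of the graph seen through `h` is a tree up to a
distance of about `ℓ / 2`. -/
def Tangled (G : Multigraph V E) (ℓ : ℕ) (h : E × Bool) : Prop :=
  ∃ F : Finset E, F.card ≤ ℓ ∧ h.1 ∈ F ∧ ∀ y, y ≠ G.base h → G.degIn F y ≠ 1

lemma Tangled.mono {ℓ' : ℕ} (hℓ : ℓ ≤ ℓ') (ht : G.Tangled ℓ h) : G.Tangled ℓ' h := by
  obtain ⟨F, hF, hF'⟩ := ht
  exact ⟨F, hF.trans hℓ, hF'⟩

variable [DecidableEq E]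

lemma degIn_eq_degIn_erase_add (hh : h.1 ∈ F) (y : V) :
    G.degIn F y = G.degIn (F.erase h.1) y + (if G.base h = y then 1 else 0) +
      if G.opposite h = y then 1 else 0 := by
  have hsum (F : Finset E) : G.degIn F y = ∑ e ∈ F, ∑ b, if G.base (e, b) = y then 1 else 0 := by
    rw [degIn, Finset.card_filter, Finset.sum_product]
  rw [hsum, hsum, ← Finset.sum_erase_add _ _ hh, add_assoc]
  obtain ⟨e, b⟩ := h
  cases b
  · exact congrArg _ ((Fintype.sum_bool _).trans (add_comm _ _))
  · exact congrArg _ (Fintype.sum_bool _)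

lemma degIn_insert_of_ne (hb : G.base h ≠ y) (ho : G.opposite h ≠ y) :
    G.degIn (insert h.1 F) y = G.degIn F y := by
  by_cases hF : h.1 ∈ F
  · rw [Finset.insert_eq_of_mem hF]
  · rw [degIn_eq_degIn_erase_add (Finset.mem_insert_self h.1 F), Finset.erase_insert hF, if_neg hb,
      if_neg ho, add_zero, add_zero]

lemma degIn_union_le (F F' : Finset E) (y : V) :
    G.degIn (F ∪ F') y ≤ G.degIn F y + G.degIn F' y := by
  rw [degIn, Finset.union_product, Finset.filter_union]
  exact Finset.card_union_le _ _

lemma degIn_union_ne_one (hF : G.degIn F y ≠ 1) (hF' : G.degIn F' y ≠ 1) :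
    G.degIn (F ∪ F') y ≠ 1 := by
  have := degIn_mono (G := G) (Finset.subset_union_left (s₁ := F) (s₂ := F')) y
  have := degIn_mono (G := G) (Finset.subset_union_right (s₁ := F) (s₂ := F')) y
  have := degIn_union_le (G := G) F F' y
  omega

lemma degIn_biUnion_ne_one {ι : Type*} (S : Finset ι) {F : ι → Finset E}
    (hF : ∀ i ∈ S, G.degIn (F i) y ≠ 1) : G.degIn (S.biUnion F) y ≠ 1 := by
  classical
  induction S using Finset.induction_on with
  | empty => simp [degIn]
  | insert i S _ ih =>
    rw [Finset.biUnion_insert]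
    exact degIn_union_ne_one (hF i (Finset.mem_insert_self i S))
      (ih fun j hj => hF j (Finset.mem_insert_of_mem hj))

lemma degIn_insert_ne_one_of_next (hb : G.base h' = G.opposite h) (hne : h' ≠ rev h)
    (hh' : h'.1 ∈ F) (hy : y ≠ G.base h) (hF : y ≠ G.opposite h → G.degIn F y ≠ 1) :
    G.degIn (insert h.1 F) y ≠ 1 := by
  by_cases hw : y = G.opposite h
  · have htwo : ({h', rev h} : Finset _).card ≤ G.degIn (insert h.1 F) y :=
      card_le_degIn (by simp [hh', hb, hw, fst_rev, base_rev])
    rw [Finset.card_pair hne] at htwo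
    omega
  · rw [degIn_insert_of_ne (Ne.symm hy) (Ne.symm hw)]
    exact hF hw

omit [DecidableEq E] in
lemma Tangled.of_next (ht : G.Tangled ℓ h') (hb : G.base h' = G.opposite h) (hne : h' ≠ rev h) :
    G.Tangled (ℓ + 1) h := by
  classical
  obtain ⟨F, hcard, hh', hF⟩ := ht
  exact ⟨insert h.1 F, (Finset.card_insert_le _ _).trans (by omega), by simp, fun y hy =>
    degIn_insert_ne_one_of_next hb hne hh' hy fun hw => hF y (by rwa [hb])⟩

omit [DecidableEq E] in
-- Erase the edge at the leaf `z`. This can only create a leaf at the other end of that edge, where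
-- the pruning continues; it never gets past `G.opposite h`, whose degree is too large.
lemma exists_leafless_subset (hF : h.1 ∈ F) (h3 : 3 ≤ G.degIn F (G.opposite h))
    (hz : ∀ y, y ≠ G.base h → y ≠ z → G.degIn F y ≠ 1) :
    ∃ F' ⊆ F, h.1 ∈ F' ∧ ∀ y, y ≠ G.base h → G.degIn F' y ≠ 1 := by
  classical
  induction F using Finset.strongInduction generalizing z with
  | H F ih =>
  by_cases hleaf : z ≠ G.base h ∧ G.degIn F z = 1
  swap
  · exact ⟨F, subset_rfl, hF, by grind⟩
  obtain ⟨hzv, hz1⟩ := hleaf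
  have hzw : z ≠ G.opposite h := by rintro rfl; omega
  obtain ⟨g, hg⟩ := Finset.card_pos.1 (show 0 < G.degIn F z by omega)
  simp only [Finset.mem_filter, Finset.mem_product, Finset.mem_univ, and_true] at hg
  obtain ⟨hgF, hgz⟩ := hg
  have hdeg := degIn_eq_degIn_erase_add (G := G) hgF
  have hgh : g.1 ≠ h.1 := fun e => by grind [base_eq_of_fst_eq (G := G) e]
  have hmem : h.1 ∈ F.erase g.1 := Finset.mem_erase.2 ⟨hgh.symm, hF⟩
  have hother : ∀ y, y ≠ G.base h → y ≠ G.opposite g → G.degIn (F.erase g.1) y ≠ 1 := by grind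
  by_cases hw : G.opposite g = G.opposite h
  · exact ⟨F.erase g.1, Finset.erase_subset _ _, hmem, by grind⟩
  · obtain ⟨F', hs, hF'⟩ := ih _ (Finset.erase_ssubset hgF) hmem (by grind) hother
    exact ⟨F', hs.trans (Finset.erase_subset _ _), hF'⟩

omit [DecidableEq E] in
lemma exists_leafless_of_tangled {S : Finset (E × Bool)}
    (hS : ∀ h ∈ S, G.Tangled ℓ h ∧ G.base h = v) :
    ∃ F : Finset E, F.card ≤ S.card * ℓ ∧ S.card ≤ G.degIn F v ∧
      ∀ y, y ≠ v → G.degIn F y ≠ 1 := by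
  classical
  choose! F hcard hmem hF using fun h hh => (hS h hh).1
  exact ⟨S.biUnion F, Finset.card_biUnion_le_card_mul S F ℓ hcard,
    card_le_degIn fun h hh => ⟨Finset.mem_biUnion.2 ⟨h, hh, hmem h hh⟩, (hS h hh).2⟩,
    fun y hy => degIn_biUnion_ne_one S fun h hh => hF h hh y (by rwa [(hS h hh).2])⟩

section Onward

variable [Fintype E]

omit [DecidableEq E] in
lemma mem_halfEdges : h ∈ G.halfEdges v ↔ G.base h = v := by simp [halfEdges]

/-- The half-edges by which a non-backtracking walk can continue after it has crossed the edge of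
`h`: those at the far end of `h`, without the other half of `h`. -/
def onward (G : Multigraph V E) (h : E × Bool) : Finset (E × Bool) :=
  (G.halfEdges (G.opposite h)).erase (rev h)

lemma mem_onward : h' ∈ G.onward h ↔ h' ≠ rev h ∧ G.base h' = G.opposite h := by
  simp [onward, mem_halfEdges]

/-- The vertices at the ends of the non-backtracking walks with `j + 1` steps that start with the
half-edge `h`. -/
def leafSet (G : Multigraph V E) : ℕ → E × Bool → Finset V
  | 0, h => {G.opposite h}
  | j + 1, h => (G.onward h).biUnion (leafSet G j)

lemma mem_leafSet_zero : z ∈ G.leafSet 0 h ↔ z = G.opposite h := Finset.mem_singleton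

lemma mem_leafSet_succ : z ∈ G.leafSet (j + 1) h ↔ ∃ h' ∈ G.onward h, z ∈ G.leafSet j h' :=
  Finset.mem_biUnion

lemma exists_leafless_of_mem_leafSet (hz : z ∈ G.leafSet j h) :
    ∃ F : Finset E, F.card ≤ j + 1 ∧ h.1 ∈ F ∧
      ∀ y, y ≠ G.base h → y ≠ z → G.degIn F y ≠ 1 := by
  induction j generalizing h with
  | zero =>
    rw [mem_leafSet_zero] at hz
    refine ⟨{h.1}, by simp, by simp, fun y hb ho => ?_⟩
    rw [← insert_empty_eq, degIn_insert_of_ne (Ne.symm hb) (hz ▸ Ne.symm ho)]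
    simp [degIn]
  | succ j ih =>
    obtain ⟨h', hh', hz⟩ := mem_leafSet_succ.1 hz
    obtain ⟨hne, hb⟩ := mem_onward.1 hh'
    obtain ⟨F, hcard, hmem, hF⟩ := ih hz
    exact ⟨insert h.1 F, (Finset.card_insert_le _ _).trans (by omega), by simp, fun y hy hyz =>
      degIn_insert_ne_one_of_next hb hne hmem hy fun hw => hF y (by rwa [hb]) hyz⟩

-- Two walks that start differently and meet again enclose a cycle: the union of their edges has at
-- most one leaf besides the vertex of `h`, namely the vertex where they meet, and can be pruned.
lemma disjoint_leafSet (ht : ¬ G.Tangled (2 * j + 3) h) (hh' : h' ∈ G.onward h)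
    (hh'' : h'' ∈ G.onward h) (hne : h' ≠ h'') : Disjoint (G.leafSet j h') (G.leafSet j h'') := by
  rw [Finset.disjoint_left]
  intro z hz' hz''
  refine ht ?_
  obtain ⟨hr', hb'⟩ := mem_onward.1 hh'
  obtain ⟨hr'', hb''⟩ := mem_onward.1 hh''
  obtain ⟨F', hcard', hmem', hF'⟩ := exists_leafless_of_mem_leafSet hz'
  obtain ⟨F'', hcard'', hmem'', hF''⟩ := exists_leafless_of_mem_leafSet hz''
  have hthree : 3 ≤ G.degIn (insert h.1 (F' ∪ F'')) (G.opposite h) := by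
    rw [← Finset.card_eq_three.2 ⟨rev h, h', h'', hr'.symm, hr''.symm, hne, rfl⟩]
    exact card_le_degIn (by simp [hmem', hmem'', hb', hb'', fst_rev, base_rev])
  have hleaf : ∀ y, y ≠ G.base h → y ≠ z → G.degIn (insert h.1 (F' ∪ F'')) y ≠ 1 :=
    fun y hy hyz => degIn_insert_ne_one_of_next hb' hr' (Finset.mem_union_left _ hmem') hy
      fun hw => degIn_union_ne_one (hF' y (by rwa [hb']) hyz) (hF'' y (by rwa [hb'']) hyz)
  obtain ⟨F, hsub, hmem, hF⟩ :=
    exists_leafless_subset (Finset.mem_insert_self _ _) hthree hleaf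
  refine ⟨F, (Finset.card_le_card hsub).trans ?_, hmem, hF⟩
  have := Finset.card_insert_le h.1 (F' ∪ F'')
  have := Finset.card_union_le F' F''
  omega

end Onward

end Multigraph

/-! ### The protocol seen through a half-edge -/

section ColourThrough

open Multigraph

variable {V E : Type} [DecidableEq E]
variable {G : Multigraph V E} {polls : ℕ × V → Finset (E × Bool)} {c c' : V → Colour} {j : ℕ}
  {h : E × Bool}

/-- The colour at time `j` of the far end of `h`, if every vertex regards the vertex from which it
is reached as red. This makes the opinions of distinct branches of a tree independent, at the price
of one red vote at every vertex. -/
def colourThrough (G : Multigraph V E) (polls : ℕ × V → Finset (E × Bool)) (c : V → Colour) :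
    ℕ → E × Bool → Colour
  | 0, h => c (G.opposite h)
  | j + 1, h =>
      if (polls (j, G.opposite h)).card < 2 * ((polls (j, G.opposite h)).filter fun h' =>
        h' = rev h ∨ colourThrough G polls c j h' = .red).card
      then .red else .blue

lemma colourThrough_succ_eq_red_iff :
    colourThrough G polls c (j + 1) h = .red ↔
      (polls (j, G.opposite h)).card < 2 * ((polls (j, G.opposite h)).filter fun h' =>
        h' = rev h ∨ colourThrough G polls c j h' = .red).card := by
  simp [colourThrough]

lemma colourThrough_congr [DecidableEq V] [Fintype E]
    (hp : ∀ i v, polls (i, v) ⊆ G.halfEdges v) (hc : ∀ v ∈ G.leafSet j h, c v = c' v) :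
    colourThrough G polls c j h = colourThrough G polls c' j h := by
  induction j generalizing h with
  | zero => exact hc _ (mem_leafSet_zero.2 rfl)
  | succ j ih =>
    have hiff : ∀ h' ∈ polls (j, G.opposite h),
        (h' = rev h ∨ colourThrough G polls c j h' = .red) ↔
          (h' = rev h ∨ colourThrough G polls c' j h' = .red) := by
      intro h' hh'
      by_cases hrev : h' = rev h
      · simp only [hrev, true_or]
      · have hon : h' ∈ G.onward h := mem_onward.2 ⟨hrev, mem_halfEdges.1 (hp _ _ hh')⟩
        rw [ih fun v hv => hc v (mem_leafSet_succ.2 ⟨h', hon, hv⟩)]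
    simp only [colourThrough, Finset.filter_congr hiff]

omit [DecidableEq E] in
lemma colourAt_succ_eq_red_iff {v : V} :
    colourAt G c polls (j + 1) v = .red ↔ (polls (j, v)).card <
      2 * ((polls (j, v)).filter fun h => colourAt G c polls j (G.opposite h) = .red).card := by
  simp [colourAt]

lemma colourThrough_eq_red_of_colourAt (hc : colourAt G c polls j (G.opposite h) = .red) :
    colourThrough G polls c j h = .red := by
  induction j generalizing h with
  | zero => exact hc
  | succ j ih =>
    rw [colourThrough_succ_eq_red_iff]
    refine (colourAt_succ_eq_red_iff.1 hc).trans_le (Nat.mul_le_mul_left 2 (Finset.card_le_card ?_))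
    exact Finset.monotone_filter_right _ fun h' _ hh' => Or.inr (ih hh')

end ColourThrough

/-! ### Majority votes of independent branches -/

section Independence

variable {V ι Ω : Type*} [Fintype V] [MeasurableSpace Ω] [Finite Ω] [DiscreteMeasurableSpace Ω]
  {ν : V → Measure Ω} [∀ v, IsProbabilityMeasure (ν v)]

lemma measureReal_inter_of_dependsOn {p q : (V → Ω) → Prop} {S T : Finset V}
    (hp : DependsOn p S) (hq : DependsOn q T) (hST : Disjoint S T) :
    (Measure.pi ν).real ({c | p c} ∩ {c | q c}) =
      (Measure.pi ν).real {c | p c} * (Measure.pi ν).real {c | q c} := by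
  have hind := (iIndepFun_pi (μ := ν) (X := fun _ => id)
    (fun _ => aemeasurable_id)).indepFun_finset S T hST measurable_pi_apply
  have hpre {p : (V → Ω) → Prop} {S : Finset V} (hp : DependsOn p S) :
      {c | p c} =
        (fun (c : V → Ω) (i : S) => id (c i)) ⁻¹' {x | ∃ c, p c ∧ ∀ i : S, c i = x i} := by
    ext c
    exact ⟨fun hc => ⟨c, hc, fun _ => rfl⟩,
      fun ⟨_, hc', h⟩ => (hp fun v hv => h ⟨v, hv⟩).to_iff.1 hc'⟩
  rw [hpre hp, hpre hq, measureReal_def, measureReal_def, measureReal_def, ← ENNReal.toReal_mul]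
  exact congrArg _ (hind.measure_inter_preimage_eq_mul _ _ .of_discrete .of_discrete)

variable {p : ι → (V → Ω) → Prop} [∀ i, DecidablePred (p i)] {S : ι → Finset V} {I : Finset ι}
  {x : ℝ} {s : ℕ}

omit [Fintype V] [MeasurableSpace Ω] [Finite Ω] [DiscreteMeasurableSpace Ω] in
lemma dependsOn_card_filter [DecidableEq V] (hp : ∀ i ∈ I, DependsOn (p i) (S i)) :
    DependsOn (fun c => (I.filter (p · c)).card) (I.biUnion S) := fun _ _ h =>
  congrArg _ <| Finset.filter_congr fun i hi =>
    (hp i hi fun _ hv => h _ (Finset.mem_coe.2 (Finset.mem_biUnion.2 ⟨i, hi, hv⟩))).to_iff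

lemma measureReal_succ_le_card_filter_insert [DecidableEq ι] {a : ι} (ha : a ∉ I)
    (hS : (insert a I : Set ι).PairwiseDisjoint S) (hp : ∀ i ∈ insert a I, DependsOn (p i) (S i))
    (k : ℕ) :
    (Measure.pi ν).real {c | k + 1 ≤ ((insert a I).filter (p · c)).card} =
      (Measure.pi ν).real {c | p a c} * (Measure.pi ν).real {c | k ≤ (I.filter (p · c)).card} +
        (1 - (Measure.pi ν).real {c | p a c}) *
          (Measure.pi ν).real {c | k + 1 ≤ (I.filter (p · c)).card} := by
  classical
  simp only [Finset.forall_mem_insert] at hp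
  have hcount (k) : DependsOn (fun c => k ≤ (I.filter (p · c)).card) (I.biUnion S) := fun _ _ h =>
    congrArg (k ≤ ·) (dependsOn_card_filter hp.2 h)
  have hnot : DependsOn (fun c => ¬ p a c) (S a) := fun _ _ h => congrArg Not (hp.1 h)
  have hdisj : Disjoint (S a) (I.biUnion S) := (Finset.disjoint_biUnion_right _ _ _).2
    fun i hi => hS (Set.mem_insert _ _) (Set.mem_insert_of_mem _ hi) (by grind)
  have hsplit : {c | k + 1 ≤ ((insert a I).filter (p · c)).card} =
      ({c | p a c} ∩ {c | k ≤ (I.filter (p · c)).card}) ∪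
        ({c | ¬ p a c} ∩ {c | k + 1 ≤ (I.filter (p · c)).card}) := by
    ext c
    by_cases hc : p a c <;> simp [Finset.filter_insert, hc, ha]
  have hdisj' : Disjoint {c | p a c} {c | ¬ p a c} := disjoint_compl_right
  have hcompl : (Measure.pi ν).real {c | ¬ p a c} = 1 - (Measure.pi ν).real {c | p a c} :=
    probReal_compl_eq_one_sub .of_discrete
  rw [hsplit, measureReal_union (hdisj'.mono Set.inter_subset_left Set.inter_subset_left)
    .of_discrete, measureReal_inter_of_dependsOn hp.1 (hcount k) hdisj,
    measureReal_inter_of_dependsOn hnot (hcount (k + 1)) hdisj, hcompl]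

lemma measureReal_card_filter_le_binTail (h0 : 0 ≤ x) (h1 : x ≤ 1)
    (hS : (I : Set ι).PairwiseDisjoint S) (hp : ∀ i ∈ I, DependsOn (p i) (S i))
    (hpx : ∀ i ∈ I, (Measure.pi ν).real {c | p i c} ≤ x) (k : ℕ) :
    (Measure.pi ν).real {c | k ≤ (I.filter (p · c)).card} ≤ binTail I.card k x := by
  classical
  induction I using Finset.induction_on generalizing k with
  | empty => cases k <;> simp
  | insert a I ha ih =>
    cases k with
    | zero => simp
    | succ k =>
      rw [Finset.coe_insert] at hS
      rw [measureReal_succ_le_card_filter_insert ha hS hp, Finset.card_insert_of_notMem ha,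
        binTail_succ_succ]
      simp only [Finset.forall_mem_insert] at hp hpx
      have ih := ih (hS.subset (Set.subset_insert _ _)) hp.2 hpx.2
      have hmono := binTail_succ_le h0 h1 I.card k
      have hnonneg : 0 ≤ (Measure.pi ν).real {c | p a c} := measureReal_nonneg
      nlinarith [ih k, ih (k + 1), hpx.1]

lemma measureReal_majority_le [DecidableEq ι] {a : ι} {P : Finset ι} (h0 : 0 ≤ x) (h1 : x ≤ 1)
    (hP : P.card = 2 * s + 1) (hS : (P.erase a : Set ι).PairwiseDisjoint S)
    (hp : ∀ i ∈ P.erase a, DependsOn (p i) (S i))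
    (hpx : ∀ i ∈ P.erase a, (Measure.pi ν).real {c | p i c} ≤ x) :
    (Measure.pi ν).real {c | P.card < 2 * (P.filter fun i => i = a ∨ p i c).card} ≤
      majorityMap s x := by
  have hbound := measureReal_card_filter_le_binTail h0 h1 hS hp hpx
  by_cases ha : a ∈ P
  · have hcard : (P.erase a).card = 2 * s := by rw [Finset.card_erase_of_mem ha, hP]; rfl
    rw [majorityMap, ← hcard]
    refine (measureReal_mono fun c (hc : P.card < _) => ?_).trans (hbound s)
    have hsub : (P.filter fun i => i = a ∨ p i c) ⊆ insert a ((P.erase a).filter (p · c)) := by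
      grind
    have := (Finset.card_le_card hsub).trans (Finset.card_insert_le _ _)
    rw [Set.mem_ofPred_eq]
    omega
  · rw [Finset.erase_eq_of_notMem ha, hP] at hbound
    refine (measureReal_mono fun c (hc : P.card < _) => ?_).trans
      ((hbound (s + 1)).trans (binTail_succ_succ_le h0 h1 _ _))
    have hcongr : (P.filter fun i => i = a ∨ p i c) = P.filter (p · c) := by grind
    rw [hcongr] at hc
    rw [Set.mem_ofPred_eq]
    omega

end Independence

instance : Fintype Colour := ⟨{.red, .blue}, fun c => by cases c <;> decide⟩

instance : DiscreteMeasurableSpace Colour := ⟨fun _ => trivial⟩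

section Colours

open Multigraph

variable {V E : Type} [Fintype V] [DecidableEq V] [Fintype E] [DecidableEq E]
  {G : Multigraph V E} {polls : ℕ × V → Finset (E × Bool)} {α : unitInterval} {r : ℕ}

omit [DecidableEq V] in
lemma measureReal_initial_eq_red (α : unitInterval) (v : V) :
    (Measure.pi fun _ : V => bernoulliMeasure Colour.red Colour.blue α).real {c | c v = .red} =
      α := by
  have hpre : {c : V → Colour | c v = .red} =
      Function.eval (β := fun _ => Colour) v ⁻¹' {Colour.red} := rfl
  rw [hpre, measureReal_def, (measurePreserving_eval _ v).measure_preimage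
      MeasurableSet.of_discrete.nullMeasurableSet, ← measureReal_def,
    bernoulliMeasure_real_apply _ MeasurableSet.of_discrete]
  simp

lemma measureReal_colourThrough_le (hr : 1 ≤ r)
    (hα : ∀ j, (majorityMap r)^[j] α ∈ Set.Icc (0 : ℝ) (1 / 2))
    (hp : ∀ i v, polls (i, v) ⊆ G.halfEdges v)
    (hodd : ∀ i v, ∃ s, r ≤ s ∧ (polls (i, v)).card = 2 * s + 1) (j : ℕ) {h : E × Bool}
    (ht : ¬ G.Tangled (2 * j + 1) h) :
    (Measure.pi fun _ : V => bernoulliMeasure Colour.red Colour.blue α).real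
      {c | colourThrough G polls c j h = .red} ≤ (majorityMap r)^[j] α := by
  induction j generalizing h with
  | zero => exact (measureReal_initial_eq_red α _).le
  | succ j ih =>
    have hnext : ∀ h' ∈ (polls (j, G.opposite h)).erase (rev h), h' ∈ G.onward h := fun h' hh' =>
      mem_onward.2 ⟨Finset.ne_of_mem_erase hh',
        mem_halfEdges.1 (hp _ _ (Finset.mem_of_mem_erase hh'))⟩
    obtain ⟨s, hs, hcard⟩ := hodd j (G.opposite h)
    rw [Function.iterate_succ_apply']
    refine le_trans ?_ (majorityMap_anti (hα j).1 (hα j).2 hr hs)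
    simp only [colourThrough_succ_eq_red_iff]
    refine measureReal_majority_le (p := fun h' c => colourThrough G polls c j h' = .red)
      (S := G.leafSet j) (hα j).1 ((hα j).2.trans (by norm_num)) hcard
      (fun a ha b hb hab => disjoint_leafSet ht (hnext a ha) (hnext b hb) hab)
      (fun i _ c c' hc => congrArg (· = .red) (colourThrough_congr hp hc))
      fun i hi => ih fun ht' => ht ?_
    have hi := mem_onward.1 (hnext i hi)
    exact (ht'.of_next hi.2 hi.1).mono (by omega)

end Colours

section Measurability

variable {V E : Type} {G : Multigraph V E}

lemma measurable_colourThrough [Finite E] [DecidableEq E] (c : V → Colour) (j : ℕ)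
    (h : E × Bool) :
    Measurable fun polls : ℕ × V → Finset (E × Bool) => colourThrough G polls c j h := by
  induction j generalizing h with
  | zero => exact measurable_const
  | succ j ih =>
    have hm : Measurable fun polls : ℕ × V → Finset (E × Bool) =>
        (polls (j, G.opposite h), fun h' => colourThrough G polls c j h') :=
      (measurable_pi_apply _).prodMk (measurable_pi_iff.2 ih)
    exact (Measurable.of_discrete (f := fun q : Finset (E × Bool) × (E × Bool → Colour) =>
      if q.1.card < 2 * (q.1.filter fun h' => h' = Multigraph.rev h ∨ q.2 h' = .red).card
      then Colour.red else Colour.blue)).comp hm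

lemma measurable_colourAt [Finite V] [Finite E] (c : V → Colour) (j : ℕ) :
    Measurable fun polls : ℕ × V → Finset (E × Bool) => colourAt G c polls j := by
  induction j with
  | zero => exact measurable_const
  | succ j ih =>
    refine measurable_pi_iff.2 fun v => ?_
    have hm : Measurable fun polls : ℕ × V → Finset (E × Bool) =>
        (polls (j, v), colourAt G c polls j) := (measurable_pi_apply _).prodMk ih
    exact (Measurable.of_discrete (f := fun q : Finset (E × Bool) × (V → Colour) =>
      if q.1.card < 2 * (q.1.filter fun h => q.2 (G.opposite h) = .red).card
      then Colour.red else Colour.blue)).comp hm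

end Measurability

/-! ### Polls -/

lemma card_filter_mem_powersetCard_mul {ι : Type*} [DecidableEq ι] {A : Finset ι} {a : ι}
    (ha : a ∈ A) (s : ℕ) :
    ((A.powersetCard s).filter (a ∈ ·)).card * A.card = s * (A.powersetCard s).card := by
  cases s with
  | zero => simp
  | succ s =>
    obtain ⟨n, hn⟩ := Nat.exists_eq_succ_of_ne_zero (Finset.card_ne_zero_of_mem ha)
    have hcard := Finset.card_filter_powersetCard_subset {a} A (s + 1)
      (Finset.singleton_subset_iff.2 ha) (by simp)
    simp only [Finset.singleton_subset_iff, Finset.card_singleton, Nat.add_sub_cancel, hn,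
      Nat.succ_eq_add_one] at hcard
    rw [hcard, Finset.card_powersetCard, hn, mul_comm (s + 1), ← Nat.add_one_mul_choose_eq,
      mul_comm]

lemma pollSize_le_left (k D : ℕ) : pollSize k D ≤ k := by
  unfold pollSize
  split_ifs <;> omega

section Protocol

open Multigraph

variable {V E : Type} [DecidableEq V] [Fintype E] {G : Multigraph V E}
  {polls : ℕ × V → Finset (E × Bool)} {α : unitInterval} {k n r : ℕ}

lemma pollLaw_mem_le {v : V} {h : E × Bool} (hh : h ∈ G.halfEdges v) (k : ℕ) :
    (pollLaw G k v).toMeasure.real {S | h ∈ S} ≤ k / G.degree v := by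
  classical
  have hdeg : (0 : ℝ) < G.degree v := Nat.cast_pos.2 (Finset.card_pos.2 ⟨h, hh⟩)
  have hpoll : (0 : ℝ) < ((G.halfEdges v).powersetCard (pollSize k (G.degree v))).card :=
    Nat.cast_pos.2 <| Finset.card_pos.2 <|
      Finset.powersetCard_nonempty.2 (pollSize_le k (G.degree v))
  rw [measureReal_def, pollLaw,
    PMF.toMeasure_uniformOfFinset_apply _ _ (measurableSet_mem_finset h), ENNReal.toReal_div,
    ENNReal.toReal_natCast, ENNReal.toReal_natCast, div_le_div_iff₀ hpoll hdeg]
  simp only [Set.mem_ofPred_eq, degree]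
  have hmul := card_filter_mem_powersetCard_mul hh (pollSize k (G.degree v))
  have hle := hmul.trans_le (Nat.mul_le_mul_right _ (pollSize_le_left k (G.degree v)))
  exact_mod_cast hle

/-- Every poll is a set of the prescribed size of half-edges at its vertex. -/
def ValidPolls (G : Multigraph V E) (k : ℕ) (polls : ℕ × V → Finset (E × Bool)) : Prop :=
  ∀ i, polls i ∈ (G.halfEdges i.2).powersetCard (pollSize k (G.degree i.2))

lemma ValidPolls.subset (hv : ValidPolls G k polls) (j : ℕ) (v : V) :
    polls (j, v) ⊆ G.halfEdges v :=
  (Finset.mem_powersetCard.1 (hv (j, v))).1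

lemma ValidPolls.exists_card_eq (hv : ValidPolls G k polls)
    (hodd : ∀ v, ∃ s, r ≤ s ∧ pollSize k (G.degree v) = 2 * s + 1) (j : ℕ) (v : V) :
    ∃ s, r ≤ s ∧ (polls (j, v)).card = 2 * s + 1 := by
  rw [(Finset.mem_powersetCard.1 (hv (j, v))).2]
  exact hodd v

lemma ae_validPolls [Countable V] (G : Multigraph V E) (k : ℕ) :
    ∀ᵐ polls ∂(Measure.infinitePi fun i : ℕ × V => (pollLaw G k i.2).toMeasure),
      ValidPolls G k polls := by
  refine ae_all_iff.2 fun i => (measurePreserving_eval_infinitePi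
    (fun i : ℕ × V => (pollLaw G k i.2).toMeasure) i).quasiMeasurePreserving.ae ?_
  rw [ae_iff, PMF.toMeasure_apply_eq_zero_iff _ MeasurableSet.of_discrete, Set.disjoint_left]
  intro S hS
  rw [pollLaw, PMF.support_uniformOfFinset] at hS
  simpa using hS

/-! ### The probability that some vertex is red -/

open Classical in
/-- The half-edges at `v` whose surroundings are not tree-like. -/
noncomputable def tangledAt (G : Multigraph V E) (ℓ : ℕ) (v : V) : Finset (E × Bool) :=
  (G.halfEdges v).filter fun h => G.Tangled ℓ h

lemma mem_tangledAt {ℓ : ℕ} {v : V} {h : E × Bool} :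
    h ∈ tangledAt G ℓ v ↔ G.base h = v ∧ G.Tangled ℓ h := by
  simp only [tangledAt, Finset.mem_filter, mem_halfEdges]

-- A majority of at least five contains three red half-edges: one of them is not tangled, or the
-- vertex belongs to `core` and has polled a tangled half-edge.
lemma exists_of_colourAt_succ_eq_red [DecidableEq E] (hr : 2 ≤ r) {c : V → Colour}
    (hv : ValidPolls G k polls)
    (hodd : ∀ v, ∃ s, r ≤ s ∧ pollSize k (G.degree v) = 2 * s + 1) {core : Finset V}
    (hcore : ∀ v ∉ core, (tangledAt G (2 * n + 1) v).card ≤ 2) {v : V}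
    (hred : colourAt G c polls (n + 1) v = .red) :
    (∃ h, ¬ G.Tangled (2 * n + 1) h ∧ colourThrough G polls c n h = .red) ∨
      ∃ u ∈ core, ∃ h ∈ tangledAt G (2 * n + 1) u, h ∈ polls (n, u) := by
  by_contra! ⟨hthrough, hpoll⟩
  rw [colourAt_succ_eq_red_iff] at hred
  obtain ⟨s, hs, hcard⟩ := hv.exists_card_eq hodd n v
  set R := (polls (n, v)).filter fun h => colourAt G c polls n (G.opposite h) = .red
  have hR : R ⊆ tangledAt G (2 * n + 1) v := by
    intro h hh
    obtain ⟨hmem, hcol⟩ := Finset.mem_filter.1 hh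
    refine mem_tangledAt.2 ⟨mem_halfEdges.1 (hv.subset n v hmem), ?_⟩
    by_contra ht
    exact hthrough h ht (colourThrough_eq_red_of_colourAt hcol)
  by_cases hvc : v ∈ core
  · obtain ⟨h, hh⟩ : R.Nonempty := Finset.card_pos.1 (by omega)
    exact hpoll v hvc h (hR hh) (Finset.mem_filter.1 hh).1
  · have := (Finset.card_le_card hR).trans (hcore v hvc)
    omega

variable [Fintype V]

lemma protocolLaw_not_validPolls (G : Multigraph V E) (k : ℕ) (α : unitInterval) :
    (protocolLaw G k α).real {ω | ¬ ValidPolls G k ω.2} = 0 :=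
  (measureReal_eq_zero_iff).2 <|
    Measure.quasiMeasurePreserving_snd.preimage_null (ae_iff.1 (ae_validPolls G k))

lemma protocolLaw_colourThrough_le [DecidableEq E] (hr : 1 ≤ r)
    (hα : ∀ j, (majorityMap r)^[j] α ∈ Set.Icc (0 : ℝ) (1 / 2))
    (hodd : ∀ v, ∃ s, r ≤ s ∧ pollSize k (G.degree v) = 2 * s + 1) {h : E × Bool}
    (ht : ¬ G.Tangled (2 * n + 1) h) :
    (protocolLaw G k α).real {ω | colourThrough G ω.2 ω.1 n h = .red} ≤
      (majorityMap r)^[n] α := by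
  have hmeas : MeasurableSet {ω : (V → Colour) × (ℕ × V → Finset (E × Bool)) |
      colourThrough G ω.2 ω.1 n h = .red} :=
    measurable_from_prod_countable_right (fun c => measurable_colourThrough c n h)
      (measurableSet_singleton Colour.red)
  refine ENNReal.toReal_le_of_le_ofReal (hα n).1 ?_
  rw [protocolLaw, Measure.prod_apply_symm hmeas]
  calc _ ≤ ∫⁻ _, ENNReal.ofReal ((majorityMap r)^[n] α)
        ∂(Measure.infinitePi fun i : ℕ × V => (pollLaw G k i.2).toMeasure) := by
        refine lintegral_mono_ae ?_
        filter_upwards [ae_validPolls G k] with polls hv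
        exact (ENNReal.le_ofReal_iff_toReal_le (measure_ne_top _ _) (hα n).1).2
          (measureReal_colourThrough_le hr hα hv.subset (hv.exists_card_eq hodd) n ht)
    _ = _ := by rw [lintegral_const, measure_univ, mul_one]

lemma protocolLaw_mem_poll_le {v : V} {h : E × Bool} (hh : h ∈ G.halfEdges v) (k : ℕ)
    (α : unitInterval) (j : ℕ) :
    (protocolLaw G k α).real {ω | h ∈ ω.2 (j, v)} ≤ k / G.degree v := by
  have hpres := (measurePreserving_eval_infinitePi
    (fun i : ℕ × V => (pollLaw G k i.2).toMeasure) (j, v)).comp (measurePreserving_snd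
      (μ := Measure.pi fun _ : V => bernoulliMeasure Colour.red Colour.blue α))
  refine le_of_eq_of_le ?_ (pollLaw_mem_le hh k)
  exact congrArg ENNReal.toReal
    (hpres.measure_preimage (measurableSet_mem_finset h).nullMeasurableSet)

lemma protocolLaw_exists_red_le (hr : 2 ≤ r)
    (hα : ∀ j, (majorityMap r)^[j] α ∈ Set.Icc (0 : ℝ) (1 / 2))
    (hodd : ∀ v, ∃ s, r ≤ s ∧ pollSize k (G.degree v) = 2 * s + 1)
    {core : Finset V} (hcore : ∀ v ∉ core, (tangledAt G (2 * n + 1) v).card ≤ 2) :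
    (protocolLaw G k α).real {ω | ∃ v, colourAt G ω.1 ω.2 (n + 1) v = .red} ≤
      2 * Fintype.card E * (majorityMap r)^[n] α +
        ∑ u ∈ core, (tangledAt G (2 * n + 1) u).card * (k / G.degree u : ℝ) := by
  classical
  set treeLike := Finset.univ.filter fun h => ¬ G.Tangled (2 * n + 1) h
  set A : Set ((V → Colour) × (ℕ × V → Finset (E × Bool))) := {ω | ¬ ValidPolls G k ω.2}
  set B : Set ((V → Colour) × (ℕ × V → Finset (E × Bool))) :=
    ⋃ h ∈ treeLike, {ω | colourThrough G ω.2 ω.1 n h = .red}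
  set C : Set ((V → Colour) × (ℕ × V → Finset (E × Bool))) :=
    ⋃ u ∈ core, ⋃ h ∈ tangledAt G (2 * n + 1) u, {ω | h ∈ ω.2 (n, u)}
  have hsub : {ω | ∃ v, colourAt G ω.1 ω.2 (n + 1) v = .red} ⊆ A ∪ B ∪ C := by
    rintro ω ⟨v, hred⟩
    by_cases hv : ValidPolls G k ω.2
    · rcases exists_of_colourAt_succ_eq_red hr hv hodd hcore hred with
        ⟨h, ht, hh⟩ | ⟨u, hu, h, ht, hh⟩
      · exact Or.inl (Or.inr (Set.mem_biUnion (by simpa [treeLike] using ht) hh))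
      · exact Or.inr (Set.mem_biUnion hu (Set.mem_biUnion ht hh))
    · exact Or.inl (Or.inl hv)
  have hA : (protocolLaw G k α).real A = 0 := protocolLaw_not_validPolls G k α
  have hB : (protocolLaw G k α).real B ≤ 2 * Fintype.card E * (majorityMap r)^[n] α := by
    have hcard : (treeLike.card : ℝ) ≤ 2 * Fintype.card E := by
      have := treeLike.card_le_univ
      rw [Fintype.card_prod, Fintype.card_bool, mul_comm] at this
      exact_mod_cast this
    refine (measureReal_biUnion_finset_le _ _).trans ((Finset.sum_le_card_nsmul _ _ _ fun h hh =>
      protocolLaw_colourThrough_le (by omega) hα hodd (Finset.mem_filter.1 hh).2).trans ?_)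
    rw [nsmul_eq_mul]
    exact mul_le_mul_of_nonneg_right hcard (hα n).1
  have hC : (protocolLaw G k α).real C ≤
      ∑ u ∈ core, (tangledAt G (2 * n + 1) u).card * (k / G.degree u : ℝ) := by
    refine (measureReal_biUnion_finset_le _ _).trans (Finset.sum_le_sum fun u _ =>
      (measureReal_biUnion_finset_le _ _).trans ?_)
    rw [← nsmul_eq_mul]
    exact Finset.sum_le_card_nsmul _ _ _ fun h hh =>
      protocolLaw_mem_poll_le (mem_halfEdges.2 (mem_tangledAt.1 hh).1) k α n
  have hunion := (measureReal_mono hsub).trans ((measureReal_union_le (μ := protocolLaw G k α)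
    (A ∪ B) C).trans (add_le_add_left (measureReal_union_le A B) _))
  linarith

end Protocol

/-! ### The growth of the graph -/

/-- The law of `PA_n(1, δ)`, as a measure. -/
noncomputable abbrev attachmentMeasure (δ : ℝ≥0) (n : ℕ) : Measure (Attachments n) :=
  (attachmentLaw δ n).toMeasure

/-- The law of the end of the edge of the new vertex, as a measure. -/
noncomputable abbrev stepMeasure (δ : ℝ≥0) {n : ℕ} (g : Attachments n) : Measure (Fin (n + 1)) :=
  (stepLaw δ g).toMeasure

/-- The degree of the vertex `j` just before the vertex `i` is added (and `1` if `i ≤ j`). -/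
def degBefore {n : ℕ} (g : Attachments n) (i j : ℕ) : ℕ :=
  1 + ∑ a : Fin n, if (a : ℕ) < i ∧ ((g a : ℕ)) = j then 1 else 0

/-- The normalising constant of the law of the edge of vertex `n`. -/
noncomputable def stepNorm (δ : ℝ≥0) (n : ℕ) : ℝ := n * (2 + δ) + (1 + δ)

lemma integral_toMeasure_bind {ι κ : Type*} [Finite ι] [Finite κ] [MeasurableSpace ι]
    [MeasurableSpace κ] [MeasurableSingletonClass ι] [MeasurableSingletonClass κ] (p : PMF ι)
    (q : ι → PMF κ) (f : κ → ℝ) :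
    ∫ y, f y ∂(p.bind q).toMeasure = ∫ x, ∫ y, f y ∂(q x).toMeasure ∂p.toMeasure := by
  have := Fintype.ofFinite ι
  have := Fintype.ofFinite κ
  have htop : ∀ x y, p x * q x y ≠ ∞ := fun x y =>
    ENNReal.mul_ne_top (p.apply_ne_top x) ((q x).apply_ne_top y)
  simp only [PMF.integral_eq_sum, PMF.bind_apply, tsum_fintype, smul_eq_mul, Finset.mul_sum]
  rw [Finset.sum_comm]
  refine Finset.sum_congr rfl fun y _ => ?_
  rw [ENNReal.toReal_sum fun x _ => htop x y, Finset.sum_mul]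
  simp only [ENNReal.toReal_mul, mul_assoc]

section Growth

variable {δ : ℝ≥0} {n : ℕ}

lemma integral_attachmentMeasure_succ (f : Attachments (n + 1) → ℝ) :
    ∫ g, f g ∂attachmentMeasure δ (n + 1) =
      ∫ g, ∫ x, f (g.extend x) ∂stepMeasure δ g ∂attachmentMeasure δ n := by
  rw [attachmentMeasure, attachmentLaw, integral_toMeasure_bind]
  refine integral_congr_ae (ae_of_all _ fun g => ?_)
  dsimp only
  rw [← PMF.toMeasure_map (hf := measurable_of_finite _),
    integral_map (measurable_of_finite _).aemeasurable
      (measurable_of_finite _).aestronglyMeasurable]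

lemma attachmentMeasure_succ_real_le {s : Set (Attachments (n + 1))} {s' : Set (Attachments n)}
    {W : ℝ} (hs : ∀ g x, g.extend x ∈ s → g ∈ s')
    (hW : ∀ g ∈ s', (stepMeasure δ g).real {x | g.extend x ∈ s} ≤ W) :
    (attachmentMeasure δ (n + 1)).real s ≤ W * (attachmentMeasure δ n).real s' := by
  classical
  rw [← integral_indicator_one MeasurableSet.of_discrete,
    ← integral_indicator_one MeasurableSet.of_discrete, integral_attachmentMeasure_succ,
    ← integral_const_mul]
  refine integral_mono .of_finite .of_finite fun g => ?_
  have hstep : ∫ x, s.indicator (1 : Attachments (n + 1) → ℝ) (g.extend x) ∂stepMeasure δ g =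
      (stepMeasure δ g).real {x | g.extend x ∈ s} :=
    integral_indicator_one (s := {x | g.extend x ∈ s}) MeasurableSet.of_discrete
  dsimp only
  rw [hstep]
  by_cases hg : g ∈ s'
  · simpa [hg] using hW g hg
  · have hempty : {x | g.extend x ∈ s} = ∅ :=
      Set.eq_empty_of_forall_notMem fun x hx => hg (hs g x hx)
    simp [hg, hempty]

lemma one_le_degBefore (g : Attachments n) (i j : ℕ) : 1 ≤ degBefore g i j := Nat.le_add_right _ _

lemma extend_castSucc (g : Attachments n) (x : Fin (n + 1)) (a : Fin n) :
    ((g.extend x a.castSucc : Fin _) : ℕ) = g a := by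
  rw [Attachments.extend, Fin.snoc_castSucc]

lemma extend_last (g : Attachments n) (x : Fin (n + 1)) :
    ((g.extend x (Fin.last n) : Fin _) : ℕ) = x := by
  rw [Attachments.extend, Fin.snoc_last]

lemma degBefore_extend (g : Attachments n) (x : Fin (n + 1)) {i : ℕ} (hi : i ≤ n) (j : ℕ) :
    degBefore (g.extend x) i j = degBefore g i j := by
  unfold degBefore
  rw [Fin.sum_univ_castSucc]
  simp only [extend_castSucc, Fin.val_castSucc, Fin.val_last]
  simp [Nat.not_lt.2 hi]

lemma degBefore_extend_succ (g : Attachments n) (x : Fin (n + 1)) (j : ℕ) :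
    degBefore (g.extend x) (n + 1) j = degBefore g n j + if (x : ℕ) = j then 1 else 0 := by
  unfold degBefore
  rw [Fin.sum_univ_castSucc, extend_last]
  simp only [extend_castSucc, Fin.val_castSucc, Fin.val_last, Nat.lt_succ_self, true_and, add_assoc]
  congr 2
  exact Finset.sum_congr rfl fun a _ => by simp [a.isLt, Nat.lt_succ_of_lt a.isLt]

lemma degBefore_of_le (g : Attachments n) {i j : ℕ} (h : i ≤ j) : degBefore g i j = 1 := by
  refine Nat.add_eq_left.2 (Finset.sum_eq_zero fun a _ => if_neg ?_)
  rintro ⟨h1, h2⟩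
  have := (g a).isLt
  omega

lemma degree_attachmentGraph (g : Attachments n) (j : Fin n) :
    (attachmentGraph g).degree j = degBefore g n j := by
  unfold Multigraph.degree Multigraph.halfEdges degBefore
  rw [Finset.card_filter, ← Finset.univ_product_univ, Finset.sum_product]
  simp only [Fintype.sum_bool, Finset.sum_add_distrib]
  rw [add_comm]
  congr 1
  · simp [Multigraph.base, attachmentGraph]
  · simp [Multigraph.base, attachmentGraph, Fin.ext_iff]

lemma two_mul_add_one_le_stepNorm (δ : ℝ≥0) (n : ℕ) : 2 * (n : ℝ) + 1 ≤ stepNorm δ n := by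
  have hn : 0 ≤ (n : ℝ) * δ := by positivity
  unfold stepNorm
  linarith [δ.coe_nonneg]

lemma stepNorm_pos (δ : ℝ≥0) (n : ℕ) : 0 < stepNorm δ n :=
  lt_of_lt_of_le (by positivity) (two_mul_add_one_le_stepNorm δ n)

lemma stepMeasure_real_singleton (g : Attachments n) (x : Fin (n + 1)) :
    (stepMeasure δ g).real {x} = (degBefore g n x + δ) / stepNorm δ n := by
  have hlaw : (stepMeasure δ g).real {x} = (stepProb δ g x : ℝ) := by
    rw [measureReal_def, PMF.toMeasure_apply_singleton _ _ (measurableSet_singleton x)]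
    rfl
  rw [hlaw, stepProb, stepNorm]
  cases x using Fin.lastCases with
  | last => simp [degBefore_of_le g (le_refl n)]
  | cast j => simp [degree_attachmentGraph]

lemma integral_degBefore_extend (g : Attachments n) {j : ℕ} (hj : j ≤ n) (F : ℕ → ℝ) :
    ∫ x, F (degBefore (g.extend x) (n + 1) j) ∂stepMeasure δ g =
      F (degBefore g n j) + (degBefore g n j + δ) / stepNorm δ n *
        (F (degBefore g n j + 1) - F (degBefore g n j)) := by
  set x₀ : Fin (n + 1) := ⟨j, Nat.lt_succ_of_le hj⟩
  have hF : ∀ x, F (degBefore (g.extend x) (n + 1) j) = F (degBefore g n j) +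
      ({x₀} : Set (Fin (n + 1))).indicator
        (fun _ => F (degBefore g n j + 1) - F (degBefore g n j)) x := by
    intro x
    rw [degBefore_extend_succ]
    by_cases hx : x = x₀
    · simp [hx, x₀]
    · simp [hx, show (x : ℕ) ≠ j from fun h => hx (Fin.ext h)]
  simp only [hF]
  rw [integral_add .of_finite .of_finite, integral_const,
    integral_indicator_const _ (measurableSet_singleton _), stepMeasure_real_singleton]
  simp [x₀]

end Growth

/-! ### Upper bounds for degrees -/

lemma eval_add_one_ascPochhammer_mul (x : ℝ) (p : ℕ) :
    (ascPochhammer ℝ p).eval (x + 1) * x = (ascPochhammer ℝ p).eval x * (x + p) := by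
  rw [← ascPochhammer_succ_eval, ascPochhammer_succ_left]
  simp [mul_comm]

lemma pow_le_eval_ascPochhammer {x : ℝ} (hx : 0 ≤ x) (p : ℕ) :
    x ^ p ≤ (ascPochhammer ℝ p).eval x := by
  induction p with
  | zero => simp
  | succ p ih =>
    rw [ascPochhammer_succ_eval, pow_succ]
    gcongr
    · exact (pow_nonneg hx p).trans ih
    · simp

lemma eval_ascPochhammer_le_pow {x : ℝ} (hx : 0 ≤ x) (p : ℕ) :
    (ascPochhammer ℝ p).eval x ≤ (x + p) ^ p := by
  induction p with
  | zero => simp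
  | succ p ih =>
    rw [ascPochhammer_succ_eval, pow_succ]
    gcongr
    · exact ih.trans (by gcongr; simp)
    · simp

section DegreeUpperBound

variable {δ : ℝ≥0} {n : ℕ}

lemma one_add_inv_stepNorm_mul_sqrt_le (δ : ℝ≥0) (n : ℕ) {y : ℝ} (hy : 0 < y) :
    (1 + 1 / stepNorm δ n) * √((4 * n + 1) / y) ≤ √((4 * (n + 1) + 1) / y) := by
  have hN : 1 / stepNorm δ n ≤ 1 / (2 * n + 1) :=
    one_div_le_one_div_of_le (by positivity) (two_mul_add_one_le_stepNorm δ n)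
  have hN0 := one_div_pos.2 (stepNorm_pos δ n)
  apply Real.le_sqrt_of_sq_le
  rw [mul_pow, Real.sq_sqrt (by positivity), ← mul_div_assoc]
  apply div_le_div_of_nonneg_right _ hy.le
  calc (1 + 1 / stepNorm δ n) ^ 2 * (4 * n + 1 : ℝ)
      ≤ (1 + 1 / (2 * n + 1)) ^ 2 * (4 * n + 1 : ℝ) := by gcongr
    _ = (2 * n + 2) ^ 2 * (4 * n + 1 : ℝ) / (2 * n + 1) ^ 2 := by field_simp; ring
    _ ≤ _ := by
      rw [div_le_iff₀ (by positivity)]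
      nlinarith [(Nat.cast_nonneg n : (0 : ℝ) ≤ n)]

lemma integral_ascPochhammer_degBefore_le {j : ℕ} (hj : j ≤ n) (p : ℕ) :
    ∫ g, (ascPochhammer ℝ p).eval (degBefore g n j + δ : ℝ) ∂attachmentMeasure δ n ≤
      (ascPochhammer ℝ p).eval (1 + δ : ℝ) * √((4 * n + 1) / (4 * j + 1)) ^ p := by
  induction n, hj using Nat.le_induction with
  | base =>
    have hne : (4 * j + 1 : ℝ) ≠ 0 := by positivity
    simp [degBefore_of_le _ (le_refl j), div_self hne]
  | succ n hj ih =>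
    have hN := stepNorm_pos δ n
    have hstep : ∀ g : Attachments n,
        ∫ x, (ascPochhammer ℝ p).eval (degBefore (g.extend x) (n + 1) j + δ : ℝ) ∂stepMeasure δ g =
          (1 + p / stepNorm δ n) * (ascPochhammer ℝ p).eval (degBefore g n j + δ : ℝ) := by
      intro g
      rw [integral_degBefore_extend g hj fun D => (ascPochhammer ℝ p).eval (D + δ : ℝ)]
      have hshift := eval_add_one_ascPochhammer_mul (degBefore g n j + δ) p
      rw [Nat.cast_add_one, add_right_comm]
      field_simp
      linear_combination hshift
    have hbernoulli : 1 + (p : ℝ) / stepNorm δ n ≤ (1 + 1 / stepNorm δ n) ^ p := by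
      rw [div_eq_mul_one_div]
      exact one_add_mul_le_pow (by linarith [one_div_pos.2 hN]) p
    have hnonneg : 0 ≤ (ascPochhammer ℝ p).eval (1 + δ : ℝ) :=
      (ascPochhammer_pos p _ (by positivity)).le
    rw [integral_attachmentMeasure_succ]
    simp only [hstep]
    rw [integral_const_mul]
    calc _ ≤ (1 + 1 / stepNorm δ n) ^ p *
          ((ascPochhammer ℝ p).eval (1 + δ : ℝ) * √((4 * n + 1) / (4 * j + 1)) ^ p) := by
          refine mul_le_mul hbernoulli ih (integral_nonneg fun g => ?_) (by positivity)
          exact (pow_nonneg (by positivity) p).trans (pow_le_eval_ascPochhammer (by positivity) p)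
      _ = (ascPochhammer ℝ p).eval (1 + δ : ℝ) *
          ((1 + 1 / stepNorm δ n) * √((4 * n + 1) / (4 * j + 1))) ^ p := by rw [mul_pow]; ring
      _ ≤ _ := by
          rw [Nat.cast_add_one]
          gcongr
          exact one_add_inv_stepNorm_mul_sqrt_le δ n (by positivity)

/-- The factor by which all degrees exceed their typical order with probability at most
exponentially small in `p`; it comes from Markov's inequality for the rising factorial moment of
order `p`. -/
noncomputable def degFactor (δ : ℝ≥0) (p : ℕ) : ℝ := 2 * (1 + δ + p) * Real.exp 2

lemma degFactor_pos (δ : ℝ≥0) (p : ℕ) : 0 < degFactor δ p := by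
  unfold degFactor
  positivity

lemma attachmentMeasure_lt_degBefore_le {j : ℕ} (hj : j ≤ n) (p : ℕ) :
    (attachmentMeasure δ n).real
        {g | degFactor δ p * √((n + 1) / (j + 1)) < (degBefore g n j + δ : ℝ)} ≤
      Real.exp (-2 * p) := by
  set q := √((n + 1 : ℝ) / (j + 1))
  have hq : 0 < q := by positivity
  have hw : 0 < degFactor δ p * q := mul_pos (degFactor_pos δ p) hq
  have hsub : {g : Attachments n | degFactor δ p * q < (degBefore g n j + δ : ℝ)} ⊆
      {g | (degFactor δ p * q) ^ p ≤ (ascPochhammer ℝ p).eval (degBefore g n j + δ : ℝ)} :=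
    fun g hg => (pow_le_pow_left₀ hw.le hg.le p).trans (pow_le_eval_ascPochhammer (by positivity) p)
  have hsqrt : √((4 * n + 1 : ℝ) / (4 * j + 1)) ≤ 2 * q := by
    rw [show (2 : ℝ) = √4 by rw [show (4 : ℝ) = 2 ^ 2 by norm_num, Real.sqrt_sq (by norm_num)],
      ← Real.sqrt_mul (by norm_num), ← mul_div_assoc]
    gcongr <;> linarith [(Nat.cast_nonneg j : (0 : ℝ) ≤ j)]
  have hmarkov := mul_meas_ge_le_integral_of_nonneg
    (ae_of_all (attachmentMeasure δ n) fun g => (pow_nonneg (by positivity) p).trans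
      (pow_le_eval_ascPochhammer (show 0 ≤ (degBefore g n j + δ : ℝ) by positivity) p))
    .of_finite ((degFactor δ p * q) ^ p)
  refine (measureReal_mono hsub).trans (le_of_mul_le_mul_left (hmarkov.trans ?_) (pow_pos hw p))
  calc _ ≤ (1 + δ + p) ^ p * (2 * q) ^ p := (integral_ascPochhammer_degBefore_le hj p).trans <| by
        gcongr
        exact eval_ascPochhammer_le_pow (by positivity) p
    _ = (degFactor δ p * q * Real.exp (-2)) ^ p := by
        rw [← mul_pow, degFactor, Real.exp_neg]
        congr 1
        field_simp
    _ = (degFactor δ p * q) ^ p * Real.exp (-2 * p) := by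
        rw [mul_pow, ← Real.exp_nat_mul, mul_comm (p : ℝ)]

/-- The degrees before the addition of vertex `i` are at most `M` times their typical order. -/
def DegOkAt (δ : ℝ≥0) (M : ℝ) (g : Attachments n) (i : ℕ) : Prop :=
  ∀ j ≤ i, (degBefore g i j + δ : ℝ) ≤ M * √((i + 1) / (j + 1))

/-- At all times the degrees are at most `M` times their typical order. -/
def DegOk (δ : ℝ≥0) (M : ℝ) (g : Attachments n) : Prop := ∀ i < n, DegOkAt δ M g i

lemma degOk_extend {M : ℝ} (g : Attachments n) (x : Fin (n + 1)) :
    DegOk δ M (g.extend x) ↔ DegOk δ M g ∧ DegOkAt δ M g n := by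
  have h : ∀ i ≤ n, (DegOkAt δ M (g.extend x) i ↔ DegOkAt δ M g i) := fun i hi => by
    simp only [DegOkAt, degBefore_extend g x hi]
  simp only [DegOk, Nat.forall_lt_succ_right, h n le_rfl]
  exact and_congr_left' (forall₂_congr fun i hi => h i hi.le)

lemma attachmentMeasure_not_degOkAt_le (p : ℕ) :
    (attachmentMeasure δ n).real {g | ¬ DegOkAt δ (degFactor δ p) g n} ≤
      (n + 1) * Real.exp (-2 * p) := by
  have hsub : {g : Attachments n | ¬ DegOkAt δ (degFactor δ p) g n} ⊆
      ⋃ j ∈ Finset.range (n + 1),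
        {g | degFactor δ p * √((n + 1) / (j + 1)) < (degBefore g n j + δ : ℝ)} := by
    intro g hg
    simpa [DegOkAt, Nat.lt_succ_iff] using hg
  refine (measureReal_mono hsub (measure_ne_top _ _)).trans <|
    (measureReal_biUnion_finset_le _ _).trans
      ((Finset.sum_le_card_nsmul _ _ _ fun j hj => attachmentMeasure_lt_degBefore_le
        (Nat.lt_succ_iff.1 (Finset.mem_range.1 hj)) p).trans_eq ?_)
  simp

lemma attachmentMeasure_not_degOk_le (p : ℕ) :
    (attachmentMeasure δ n).real {g | ¬ DegOk δ (degFactor δ p) g} ≤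
      n ^ 2 * Real.exp (-2 * p) := by
  induction n with
  | zero => simp [DegOk]
  | succ n ih =>
    set A : Set (Attachments n) := {g | ¬ DegOk δ (degFactor δ p) g}
    set B : Set (Attachments n) := {g | ¬ DegOkAt δ (degFactor δ p) g n}
    have hsucc : (attachmentMeasure δ (n + 1)).real {g | ¬ DegOk δ (degFactor δ p) g} ≤
        1 * (attachmentMeasure δ n).real (A ∪ B) :=
      attachmentMeasure_succ_real_le (fun g x hg => not_and_or.1 ((degOk_extend g x).not.1 hg))
        fun g _ => measureReal_le_one
    have hB := attachmentMeasure_not_degOkAt_le (δ := δ) (n := n) p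
    have hunion := measureReal_union_le (μ := attachmentMeasure δ n) A B
    have hn : 0 ≤ (n : ℝ) * Real.exp (-2 * p) := by positivity
    push_cast
    linarith

/-! ### The probability of given edges -/

lemma card_filter_div_eq_le {m : ℕ} (hm : 0 < m) (b : ℕ) :
    ((Finset.univ : Finset (Fin n)).filter fun x : Fin n => (x : ℕ) / m = b).card ≤ m := by
  refine (Finset.card_le_card_of_injOn (t := Finset.range m) (fun x : Fin n => (x : ℕ) % m)
    (fun x _ => by simpa using Nat.mod_lt _ hm) ?_).trans (Finset.card_range m).le
  intro x hx y hy hxy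
  simp only [Finset.coe_filter, Finset.mem_univ, true_and, Set.mem_ofPred_eq] at hx hy hxy
  apply Fin.ext
  rw [← Nat.div_add_mod (x : ℕ) m, ← Nat.div_add_mod (y : ℕ) m, hx, hy, hxy]

lemma stepMeasure_singleton_le {M : ℝ} {g : Attachments n} (hok : DegOkAt δ M g n)
    (x : Fin (n + 1)) :
    (stepMeasure δ g).real {x} ≤ M / √((n + 1) * ((x : ℕ) + 1)) := by
  have hdeg := hok x (Nat.lt_succ_iff.1 x.isLt)
  have hnorm : (n + 1 : ℝ) ≤ stepNorm δ n := by
    linarith [two_mul_add_one_le_stepNorm δ n, (Nat.cast_nonneg n : (0 : ℝ) ≤ n)]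
  have hsq : √(n + 1 : ℝ) * √(n + 1 : ℝ) = n + 1 := Real.mul_self_sqrt (by positivity)
  rw [stepMeasure_real_singleton]
  calc _ ≤ M * √((n + 1) / ((x : ℕ) + 1)) / (n + 1) :=
        div_le_div₀ ((show (0 : ℝ) ≤ degBefore g n x + δ by positivity).trans hdeg) hdeg
          (by positivity) hnorm
    _ = M / √((n + 1) * ((x : ℕ) + 1)) := by
        rw [Real.sqrt_div (by positivity), Real.sqrt_mul (by positivity), mul_div_assoc', div_div,
          div_eq_div_iff (by positivity) (by positivity)]
        linear_combination (M * √((x : ℕ) + 1 : ℝ)) * hsq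

lemma stepMeasure_block_le {M : ℝ} (hM : 0 ≤ M) {m : ℕ} (hm : 0 < m) {g : Attachments n}
    (hok : DegOkAt δ M g n) (b : ℕ) :
    (stepMeasure δ g).real {x | (x : ℕ) / m = b} ≤
      m * M / √(((n / m : ℕ) + 1) * (b + 1)) := by
  set block := (Finset.univ : Finset (Fin (n + 1))).filter fun x : Fin (n + 1) => (x : ℕ) / m = b
  have hpoint : ∀ x ∈ block, (stepMeasure δ g).real {x} ≤ M / √(((n / m : ℕ) + 1) * (b + 1)) := by
    intro x hx
    obtain rfl : (x : ℕ) / m = b := (Finset.mem_filter.1 hx).2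
    refine (stepMeasure_singleton_le hok x).trans ?_
    gcongr <;> exact Nat.div_le_self _ _
  calc _ = ∑ x ∈ block, (stepMeasure δ g).real {x} := by
        rw [sum_measureReal_singleton]
        simp [block]
    _ ≤ block.card * (M / √(((n / m : ℕ) + 1) * (b + 1))) := by
        rw [← nsmul_eq_mul]
        exact Finset.sum_le_card_nsmul _ _ _ hpoint
    _ ≤ _ := by
        rw [mul_div_assoc]
        gcongr
        exact card_filter_div_eq_le hm b

lemma attachmentMeasure_edges_le {M : ℝ} (hM : 0 ≤ M) {m : ℕ} (hm : 0 < m) (S : Finset ℕ)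
    (φ : ℕ → ℕ) :
    (attachmentMeasure δ n).real
        {g | DegOk δ M g ∧ ∀ a : Fin n, (a : ℕ) ∈ S → (g a : ℕ) / m = φ a} ≤
      ∏ i ∈ Finset.range n, if i ∈ S then m * M / √(((i / m : ℕ) + 1) * (φ i + 1)) else 1 := by
  induction n with
  | zero => simp [DegOk]
  | succ n ih =>
    have hext : ∀ (g : Attachments n) (x : Fin (n + 1)),
        g.extend x ∈ {g : Attachments (n + 1) | DegOk δ M g ∧
          ∀ a : Fin (n + 1), (a : ℕ) ∈ S → (g a : ℕ) / m = φ a} ↔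
        ((DegOk δ M g ∧ DegOkAt δ M g n) ∧ (∀ a : Fin n, (a : ℕ) ∈ S → (g a : ℕ) / m = φ a) ∧
          (n ∈ S → (x : ℕ) / m = φ n)) := by
      intro g x
      rw [Set.mem_ofPred_eq, degOk_extend, Fin.forall_fin_succ']
      simp only [extend_castSucc, extend_last, Fin.val_castSucc, Fin.val_last]
    set W : ℝ := if n ∈ S then m * M / √(((n / m : ℕ) + 1) * (φ n + 1)) else 1 with hW
    have hW0 : 0 ≤ W := by rw [hW]; split_ifs <;> positivity
    rw [Finset.prod_range_succ, mul_comm]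
    refine (attachmentMeasure_succ_real_le (W := W) (fun g x hg => ?_) fun g _ => ?_).trans
      (mul_le_mul_of_nonneg_left ih hW0)
    · exact ⟨((hext g x).1 hg).1.1, ((hext g x).1 hg).2.1⟩
    · simp only [hext]
      by_cases hok : DegOkAt δ M g n
      · by_cases hS : n ∈ S
        · rw [hW, if_pos hS]
          exact (measureReal_mono fun x hx => hx.2.2 hS).trans (stepMeasure_block_le hM hm hok _)
        · rw [hW, if_neg hS]
          exact measureReal_le_one
      · simpa [hok] using hW0

end DegreeUpperBound

/-! ### Lower bounds for degrees -/

lemma one_sub_div_mul_rpow_div_le {c x y : ℝ} (hc0 : 0 ≤ c) (hc1 : c ≤ 1) (hx : 1 ≤ x)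
    (hy : 0 ≤ y) : (1 - c / x) * (y / x) ^ c ≤ (y / (x + 1)) ^ c := by
  have hx0 : 0 < x := by linarith
  have hcx : 0 ≤ 1 - c / x := by
    rw [sub_nonneg, div_le_one hx0]
    linarith
  have hbernoulli : ((x + 1) / x) ^ c ≤ 1 + c / x := by
    have h := rpow_one_add_le_one_add_mul_self (s := 1 / x)
      (by linarith [one_div_pos.2 hx0]) hc0 hc1
    rwa [mul_one_div, one_add_div hx0.ne'] at h
  calc (1 - c / x) * (y / x) ^ c
      = (1 - c / x) * ((y / (x + 1)) ^ c * ((x + 1) / x) ^ c) := by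
        rw [← Real.mul_rpow (by positivity) (by positivity)]
        congr 2
        field_simp
    _ ≤ (1 - c / x) * ((y / (x + 1)) ^ c * (1 + c / x)) := by gcongr
    _ = (y / (x + 1)) ^ c * (1 - (c / x) ^ 2) := by ring
    _ ≤ _ := mul_le_of_le_one_right (by positivity) (sub_le_self _ (sq_nonneg _))

section DegreeLowerBound

variable {δ : ℝ≥0} {n : ℕ}

/-- An exponent such that `D_j(n)` is typically at least of the order of `(n / j) ^ degExponent`. -/
noncomputable def degExponent (δ : ℝ≥0) : ℝ := 1 / (2 * (2 + δ))

lemma degExponent_pos (δ : ℝ≥0) : 0 < degExponent δ := by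
  unfold degExponent
  positivity

lemma degExponent_le_one (δ : ℝ≥0) : degExponent δ ≤ 1 := by
  rw [degExponent, div_le_one (by positivity)]
  linarith [δ.coe_nonneg]

lemma integral_inv_degBefore_extend_le (g : Attachments n) {j : ℕ} (hj : j ≤ n) :
    ∫ x, 1 / (degBefore (g.extend x) (n + 1) j + δ : ℝ) ∂stepMeasure δ g ≤
      (1 - degExponent δ / (n + 1)) * (1 / (degBefore g n j + δ : ℝ)) := by
  have hN := stepNorm_pos δ n
  have hdeg : (1 : ℝ) ≤ degBefore g n j := by exact_mod_cast one_le_degBefore g n j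
  rw [integral_degBefore_extend g hj fun D => 1 / (D + δ : ℝ), Nat.cast_add_one, add_right_comm]
  set X := (degBefore g n j + δ : ℝ)
  have hX : 1 ≤ X := le_add_of_le_of_nonneg hdeg δ.coe_nonneg
  have hrate : degExponent δ / (n + 1) ≤ X / ((X + 1) * stepNorm δ n) := by
    have hNle : stepNorm δ n ≤ (n + 1) * (2 + δ) := by unfold stepNorm; nlinarith
    rw [degExponent, div_div, div_le_div_iff₀ (by positivity) (by positivity), one_mul]
    calc (X + 1) * stepNorm δ n ≤ (2 * X) * ((n + 1) * (2 + δ)) := by gcongr; linarith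
      _ = _ := by ring
  calc 1 / X + X / stepNorm δ n * (1 / (X + 1) - 1 / X)
      = (1 - X / ((X + 1) * stepNorm δ n)) * (1 / X) := by field_simp; ring
    _ ≤ _ := by gcongr

lemma integral_inv_degBefore_le {j : ℕ} (hj : j ≤ n) :
    ∫ g, 1 / (degBefore g n j + δ : ℝ) ∂attachmentMeasure δ n ≤
      ((j + 1 : ℝ) / (n + 1)) ^ degExponent δ := by
  induction n, hj using Nat.le_induction with
  | base =>
    have hle : (1 + δ : ℝ)⁻¹ ≤ 1 := inv_le_one_of_one_le₀ (by linarith [δ.coe_nonneg])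
    have hne : (j + 1 : ℝ) ≠ 0 := by positivity
    simpa [degBefore_of_le _ (le_refl j), div_self hne] using hle
  | succ n hj ih =>
    have hfactor : 0 ≤ 1 - degExponent δ / (n + 1) := by
      rw [sub_nonneg, div_le_one (by positivity)]
      linarith [degExponent_le_one δ, (Nat.cast_nonneg n : (0 : ℝ) ≤ n)]
    rw [integral_attachmentMeasure_succ, Nat.cast_add_one]
    calc _ ≤ (1 - degExponent δ / (n + 1)) *
          ∫ g, 1 / (degBefore g n j + δ : ℝ) ∂attachmentMeasure δ n := by
          rw [← integral_const_mul]
          exact integral_mono .of_finite .of_finite fun g => integral_inv_degBefore_extend_le g hj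
      _ ≤ (1 - degExponent δ / (n + 1)) * ((j + 1 : ℝ) / (n + 1)) ^ degExponent δ := by gcongr
      _ ≤ _ := one_sub_div_mul_rpow_div_le (degExponent_pos δ).le (degExponent_le_one δ)
          (by simp) (by positivity)

end DegreeLowerBound

/-! ### Words in which no letter but one appears exactly once -/

section Covering

variable {P ι : Type*} [Fintype P] [DecidableEq ι] {w : P → ι} {v : ι} {κ s : ℕ} {f : ι → ℝ}

/-- The number of times that the letter `y` appears in the word `w`. -/
def occurrences (w : P → ι) (y : ι) : ℕ := (Finset.univ.filter fun p => w p = y).card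

/-- The letter `v` appears at least `κ` times in `w`, and no other letter appears exactly once. For
the list of the ends of all edges of a subgraph, this means that `v` has degree at least `κ` and
that no other vertex is a leaf. -/
def Covering (κ : ℕ) (v : ι) (w : P → ι) : Prop :=
  κ ≤ occurrences w v ∧ ∀ y, y ≠ v → occurrences w y ≠ 1

lemma occurrences_ne_zero (w : P → ι) (p : P) : occurrences w (w p) ≠ 0 :=
  Finset.card_ne_zero_of_mem (a := p) (by simp)

omit [DecidableEq ι] in
lemma exists_enumeration {z₀ : ι} (hz₀ : f z₀ = 1) {Y : Finset ι} (hY : Y.card ≤ s) :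
    ∃ z : Fin s → ι, (∀ y ∈ Y, ∃ a, z a = y) ∧ ∏ a, f (z a) = ∏ y ∈ Y, f y := by
  classical
  induction Y using Finset.induction_on generalizing s with
  | empty => exact ⟨fun _ => z₀, by simp, by simp [hz₀]⟩
  | insert y Y hy ih =>
    rw [Finset.card_insert_of_notMem hy] at hY
    obtain ⟨s, rfl⟩ := Nat.exists_eq_add_of_le' (show 1 ≤ s by omega)
    obtain ⟨z, hzY, hzf⟩ := ih (s := s) (by omega)
    refine ⟨Fin.cons y z, fun y' hy' => ?_, ?_⟩
    · rcases Finset.mem_insert.1 hy' with rfl | hmem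
      · exact ⟨0, rfl⟩
      · obtain ⟨a, ha⟩ := hzY y' hmem
        exact ⟨a.succ, by simpa only [Fin.cons_succ] using ha⟩
    · rw [Fin.prod_univ_succ, Finset.prod_insert hy]
      simp only [Fin.cons_zero, Fin.cons_succ, hzf]

variable [Fintype ι]

lemma sum_occurrences (w : P → ι) : ∑ y, occurrences w y = Fintype.card P :=
  (Finset.card_eq_sum_card_fiberwise fun _ _ => Finset.mem_coe.2 (Finset.mem_univ _)).symm

lemma prod_eq_prod_pow_occurrences (w : P → ι) (f : ι → ℝ) :
    ∏ p, f (w p) = ∏ y, f y ^ occurrences w y := by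
  rw [← Finset.prod_fiberwise' Finset.univ w f]
  exact Finset.prod_congr rfl fun y _ => Finset.prod_const _

/-- The letters other than `v` that appear in the word `w`. -/
def otherLetters (w : P → ι) (v : ι) : Finset ι :=
  (Finset.univ.erase v).filter fun y => occurrences w y ≠ 0

lemma Covering.card_otherLetters_le (hw : Covering κ v w) (hP : Fintype.card P ≤ 2 * s) :
    (otherLetters w v).card ≤ s := by
  have htwice : ∑ _y ∈ otherLetters w v, 2 ≤ ∑ y ∈ otherLetters w v, occurrences w y := by
    refine Finset.sum_le_sum fun y hy => ?_
    obtain ⟨hyv, hy0⟩ := Finset.mem_filter.1 hy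
    have := hw.2 y (Finset.ne_of_mem_erase hyv)
    omega
  have hle : ∑ y ∈ otherLetters w v, occurrences w y ≤ ∑ y, occurrences w y :=
    Finset.sum_le_sum_of_subset (Finset.subset_univ _)
  rw [Finset.sum_const, smul_eq_mul] at htwice
  rw [sum_occurrences] at hle
  omega

lemma Covering.prod_le (hw : Covering κ v w) (hf : ∀ y, f y ∈ Set.Icc 0 1) :
    ∏ p, f (w p) ≤ f v ^ κ * ∏ y ∈ otherLetters w v, f y ^ 2 := by
  rw [prod_eq_prod_pow_occurrences, ← Finset.mul_prod_erase _ _ (Finset.mem_univ v), otherLetters,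
    Finset.prod_filter]
  refine mul_le_mul (pow_le_pow_of_le_one (hf v).1 (hf v).2 hw.1)
    (Finset.prod_le_prod (fun y _ => pow_nonneg (hf y).1 _) fun y hy => ?_)
    (Finset.prod_nonneg fun y _ => pow_nonneg (hf y).1 _) (pow_nonneg (hf v).1 _)
  have hy1 := hw.2 y (Finset.ne_of_mem_erase hy)
  split_ifs with hy0
  · exact pow_le_pow_of_le_one (hf y).1 (hf y).2 (by omega)
  · rw [not_not.1 hy0, pow_zero]

omit [Fintype ι] in
-- A covering word of length at most `2 * s` has at most `s` letters other than `v`; it is encoded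
-- by a list of these letters and, for every position, a place in the list or `none`, for `v`.
lemma Covering.exists_coding [Finite ι] (hw : Covering κ v w) (hP : Fintype.card P ≤ 2 * s)
    (hf : ∀ y, f y ∈ Set.Icc 0 1) {z₀ : ι} (hz₀ : f z₀ = 1) :
    ∃ q : (P → Option (Fin s)) × (Fin s → ι), (∀ p, w p = (q.1 p).elim v q.2) ∧
      ∏ p, f (w p) ≤ f v ^ κ * ∏ a, f (q.2 a) ^ 2 := by
  have := Fintype.ofFinite ι
  obtain ⟨z, hz, hzf⟩ := exists_enumeration (f := fun y => f y ^ 2) (by rw [hz₀, one_pow])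
    (hw.card_otherLetters_le hP)
  have hσ (p : P) : ∃ o : Option (Fin s), w p = o.elim v z := by
    by_cases hp : w p = v
    · exact ⟨none, hp⟩
    · obtain ⟨a, ha⟩ := hz (w p) (Finset.mem_filter.2
        ⟨Finset.mem_erase.2 ⟨hp, Finset.mem_univ _⟩, occurrences_ne_zero w p⟩)
      exact ⟨some a, ha.symm⟩
  choose σ hσ using hσ
  exact ⟨(σ, z), hσ, (hw.prod_le hf).trans_eq (by rw [hzf])⟩

open Classical in
lemma sum_covering_prod_le [DecidableEq P] (hP : Fintype.card P ≤ 2 * s)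
    (hf : ∀ y, f y ∈ Set.Icc 0 1) {z₀ : ι} (hz₀ : f z₀ = 1) (v : ι) :
    ∑ w : P → ι with Covering κ v w, ∏ p, f (w p) ≤
      (s + 1) ^ (2 * s) * (∑ y, f y ^ 2) ^ s * f v ^ κ := by
  have hcode (w : P → ι) : ∃ q : (P → Option (Fin s)) × (Fin s → ι), Covering κ v w →
      (∀ p, w p = (q.1 p).elim v q.2) ∧ ∏ p, f (w p) ≤ f v ^ κ * ∏ a, f (q.2 a) ^ 2 := by
    by_cases hw : Covering κ v w
    · exact (hw.exists_coding hP hf hz₀).imp fun _ hq _ => hq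
    · exact ⟨(fun _ => none, fun _ => v), fun h => absurd h hw⟩
  choose ψ hψ using hcode
  have hinj : Set.InjOn ψ (Finset.univ.filter fun w => Covering κ v w : Finset (P → ι)) := by
    intro w hw w' hw' he
    funext p
    rw [(hψ w (Finset.mem_filter.1 hw).2).1 p, (hψ w' (Finset.mem_filter.1 hw').2).1 p, he]
  have hv : 0 ≤ f v := (hf v).1
  calc ∑ w : P → ι with Covering κ v w, ∏ p, f (w p)
      ≤ ∑ w : P → ι with Covering κ v w, f v ^ κ * ∏ a, f ((ψ w).2 a) ^ 2 :=
        Finset.sum_le_sum fun w hw => (hψ w (Finset.mem_filter.1 hw).2).2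
    _ = ∑ q ∈ (Finset.univ.filter fun w : P → ι => Covering κ v w).image ψ,
          f v ^ κ * ∏ a, f (q.2 a) ^ 2 :=
        (Finset.sum_image (f := fun q => f v ^ κ * ∏ a, f (q.2 a) ^ 2) hinj).symm
    _ ≤ ∑ q : (P → Option (Fin s)) × (Fin s → ι), f v ^ κ * ∏ a, f (q.2 a) ^ 2 :=
        Finset.sum_le_sum_of_subset_of_nonneg (Finset.subset_univ _) fun q _ _ => by positivity
    _ = (s + 1) ^ Fintype.card P * (f v ^ κ * (∑ y, f y ^ 2) ^ s) := by
        rw [Fintype.sum_prod_type]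
        dsimp only
        rw [Finset.sum_const, ← Finset.mul_sum, ← Fintype.sum_pow fun y => f y ^ 2,
          Finset.card_univ, Fintype.card_fun,
          Fintype.card_option, Fintype.card_fin, nsmul_eq_mul, Nat.cast_pow, Nat.cast_succ]
    _ ≤ (s + 1) ^ (2 * s) * (f v ^ κ * (∑ y, f y ^ 2) ^ s) := by
        gcongr
        linarith [(Nat.cast_nonneg s : (0 : ℝ) ≤ s)]
    _ = (s + 1) ^ (2 * s) * (∑ y, f y ^ 2) ^ s * f v ^ κ := by ring

end Covering

/-! ### The expected number of small leafless subgraphs -/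

section Subgraphs

variable {δ : ℝ≥0} {m t s κ ℓ : ℕ} {M : ℝ} {v : Fin t}

/-- The far end, in `PA_t(m, δ)`, of the edge `a`. -/
def target (g : Attachments (t * m)) (a : Fin (t * m)) : Fin t :=
  (paGraph m t g).ends a true

lemma paGraph_ends_false (g : Attachments (t * m)) (a : Fin (t * m)) :
    (paGraph m t g).ends a false = a.divNat := by
  simp [paGraph, Multigraph.contract, attachmentGraph]

lemma val_target (g : Attachments (t * m)) (a : Fin (t * m)) :
    (target g a : ℕ) = (g a : ℕ) / m := by
  simp [target, paGraph, Multigraph.contract, attachmentGraph]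

lemma attachmentMeasure_forall_target_le (hM : 0 ≤ M) (hm : 0 < m) {i : Fin s → Fin (t * m)}
    (hi : Function.Injective i) (φ : Fin s → Fin t) :
    (attachmentMeasure δ (t * m)).real {g | DegOk δ M g ∧ ∀ a, target g (i a) = φ a} ≤
      (m * M) ^ s * ∏ p, 1 / √(((Sum.elim (fun a => (i a).divNat) φ p : Fin t) : ℝ) + 1) := by
  set S : Finset ℕ := Finset.univ.image fun a => (i a : ℕ) with hS
  have hival : Function.Injective fun a => (i a : ℕ) := Fin.val_injective.comp hi
  set φ' : ℕ → ℕ := Function.extend (fun a => (i a : ℕ)) (fun a => (φ a : ℕ)) 0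
  have hφ' (a : Fin s) : φ' (i a) = φ a := hival.extend_apply _ _ a
  have hsub : {g : Attachments (t * m) | DegOk δ M g ∧ ∀ a, target g (i a) = φ a} ⊆
      {g | DegOk δ M g ∧ ∀ a : Fin (t * m), (a : ℕ) ∈ S → (g a : ℕ) / m = φ' a} := by
    rintro g ⟨hdeg, hg⟩
    refine ⟨hdeg, fun a ha => ?_⟩
    obtain ⟨b, -, hb⟩ := Finset.mem_image.1 ha
    obtain rfl : i b = a := Fin.ext hb
    rw [hφ', ← hg b, val_target]
  have hSrange : S ⊆ Finset.range (t * m) :=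
    Finset.image_subset_iff.2 fun b _ => Finset.mem_range.2 (i b).isLt
  refine ((measureReal_mono hsub (measure_ne_top _ _)).trans
    (attachmentMeasure_edges_le hM hm S φ')).trans_eq ?_
  calc (∏ a ∈ Finset.range (t * m),
        if a ∈ S then m * M / √(((a / m : ℕ) + 1) * (φ' a + 1)) else 1)
      = ∏ a, m * M / √((((i a : ℕ) / m : ℕ) + 1) * (φ' (i a) + 1)) := by
        rw [Finset.prod_ite_mem, Finset.inter_eq_right.2 hSrange, hS,
          Finset.prod_image fun a _ b _ h => hival h]
    _ = ∏ a, m * M * (1 / √(((i a).divNat : ℕ) + 1) * (1 / √((φ a : ℕ) + 1))) :=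
        Finset.prod_congr rfl fun a _ => by
          rw [hφ', Real.sqrt_mul (by positivity), Fin.coe_divNat, one_div_mul_one_div, mul_one_div]
    _ = _ := by
        rw [Finset.prod_mul_distrib, Finset.prod_const, Finset.card_univ, Fintype.card_fin,
          Fintype.prod_sum_type, ← Finset.prod_mul_distrib]
        rfl

lemma sum_comp_divNat (F : (Fin s → Fin t) → ℝ) :
    ∑ i : Fin s → Fin (t * m), F (fun a => (i a).divNat) = m ^ s * ∑ x, F x := by
  have hfiber (x : Fin s → Fin t) (c : Fin s → Fin m) :
      (fun a => (finProdFinEquiv (x a, c a)).divNat) = x :=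
    funext fun a => congrArg Prod.fst (finProdFinEquiv.symm_apply_apply (x a, c a))
  rw [← Equiv.sum_comp ((Equiv.arrowProdEquivProdArrow (Fin s) (fun _ => Fin t)
    (fun _ => Fin m)).symm.trans (Equiv.arrowCongr (Equiv.refl _) finProdFinEquiv)),
    Fintype.sum_prod_type, Finset.mul_sum]
  refine Finset.sum_congr rfl fun x _ => ?_
  calc ∑ c : Fin s → Fin m, F (fun a => (finProdFinEquiv (x a, c a)).divNat)
      = ∑ _c : Fin s → Fin m, F x := Finset.sum_congr rfl fun c _ => by rw [hfiber]
    _ = m ^ s * F x := by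
      rw [Finset.sum_const, Finset.card_univ, Fintype.card_fun, Fintype.card_fin,
        Fintype.card_fin, nsmul_eq_mul, Nat.cast_pow]

lemma sum_sumElim_divNat (W : (Fin s ⊕ Fin s → Fin t) → ℝ) :
    ∑ q : (Fin s → Fin (t * m)) × (Fin s → Fin t), W (Sum.elim (fun a => (q.1 a).divNat) q.2) =
      m ^ s * ∑ w, W w := by
  rw [Fintype.sum_prod_type_right]
  simp_rw [fun φ => sum_comp_divNat (m := m) fun x => W (Sum.elim x φ)]
  rw [← Finset.mul_sum, ← Fintype.sum_prod_type_right',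
    ← Equiv.sum_comp (Equiv.sumArrowEquivProdArrow (Fin s) (Fin s) (Fin t)).symm W]
  rfl

open Classical in
/-- The sequences of `s` distinct edges of `PA_t(m, δ)`, together with potential far ends for these,
that would form a subgraph in which `v` has degree at least `κ` and no other vertex is a leaf. -/
noncomputable def potentialLeafless (m s κ : ℕ) (v : Fin t) :
    Finset ((Fin s → Fin (t * m)) × (Fin s → Fin t)) :=
  Finset.univ.filter fun q => Function.Injective q.1 ∧
    Covering κ v (Sum.elim (fun a => (q.1 a).divNat) q.2)

/-- The elements of `potentialLeafless` that are present in the graph. -/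
noncomputable def leaflessTuples (g : Attachments (t * m)) (s κ : ℕ) (v : Fin t) :
    Finset ((Fin s → Fin (t * m)) × (Fin s → Fin t)) :=
  (potentialLeafless m s κ v).filter fun q => ∀ a, target g (q.1 a) = q.2 a

lemma exists_mem_leaflessTuples (g : Attachments (t * m)) {F : Finset (Fin (t * m))}
    (hv : κ ≤ (paGraph m t g).degIn F v) (hF : ∀ y, y ≠ v → (paGraph m t g).degIn F y ≠ 1) :
    ∃ q ∈ leaflessTuples g F.card κ v, ∀ e ∈ F, ∃ a, q.1 a = e := by
  classical
  set i : Fin F.card → Fin (t * m) := fun a => F.equivFin.symm a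
  have hocc (y : Fin t) :
      occurrences (Sum.elim (fun a => (i a).divNat) fun a => target g (i a)) y =
        (paGraph m t g).degIn F y := by
    rw [occurrences, Multigraph.degIn, Finset.card_filter, Finset.card_filter,
      Fintype.sum_sum_type, ← Finset.sum_add_distrib, Finset.sum_product, ← Finset.sum_coe_sort F,
      ← Equiv.sum_comp F.equivFin.symm]
    refine Finset.sum_congr rfl fun a _ => ?_
    rw [Fintype.sum_bool, add_comm, Sum.elim_inl, Sum.elim_inr, ← paGraph_ends_false g (i a)]
    rfl
  refine ⟨(i, fun a => target g (i a)), ?_, fun e he => ⟨F.equivFin ⟨e, he⟩, by simp [i]⟩⟩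
  refine Finset.mem_filter.2 ⟨Finset.mem_filter.2 ⟨Finset.mem_univ _, ?_, ?_, ?_⟩, fun _ => rfl⟩
  · exact Subtype.val_injective.comp F.equivFin.symm.injective
  · exact hv.trans_eq (hocc v).symm
  · exact fun y hy => (hocc y).trans_ne (hF y hy)

lemma setIntegral_ite_one_zero {n : ℕ} (p q : Attachments n → Prop) [DecidablePred q] :
    ∫ g in {g | p g}, (if q g then (1 : ℝ) else 0) ∂attachmentMeasure δ n =
      (attachmentMeasure δ n).real {g | p g ∧ q g} := by
  calc ∫ g in {g | p g}, (if q g then (1 : ℝ) else 0) ∂attachmentMeasure δ n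
      = ∫ g in {g | p g}, {g | q g}.indicator 1 g ∂attachmentMeasure δ n := by
        simp only [Set.indicator_apply, Set.mem_ofPred_eq, Pi.one_apply]
    _ = (attachmentMeasure δ n).real {g | p g ∧ q g} := by
        rw [integral_indicator_one .of_discrete, measureReal_restrict_apply .of_discrete,
          Set.inter_comm]
        rfl

lemma setIntegral_card_leaflessTuples_le (hM : 0 ≤ M) (hm : 0 < m) (v : Fin t) :
    ∫ g in {g | DegOk δ M g}, ((leaflessTuples g s κ v).card : ℝ) ∂attachmentMeasure δ (t * m) ≤
      (m * (m * M)) ^ s * ((s + 1) ^ (2 * s) * (∑ y : Fin t, 1 / ((y : ℝ) + 1)) ^ s *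
        (1 / √((v : ℝ) + 1)) ^ κ) := by
  classical
  set f : Fin t → ℝ := fun y => 1 / √((y : ℝ) + 1)
  have hf (y : Fin t) : f y ∈ Set.Icc 0 1 :=
    ⟨by positivity, div_le_one_of_le₀ (Real.one_le_sqrt.2 (by simp)) (Real.sqrt_nonneg _)⟩
  have hf0 : f ⟨0, Fin.pos v⟩ = 1 := by simp [f]
  have hfsq (y : Fin t) : f y ^ 2 = 1 / ((y : ℝ) + 1) := by
    rw [div_pow, Real.sq_sqrt (by positivity), one_pow]
  have hcard : Fintype.card (Fin s ⊕ Fin s) ≤ 2 * s := by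
    rw [Fintype.card_sum, Fintype.card_fin, two_mul]
  calc ∫ g in {g | DegOk δ M g}, ((leaflessTuples g s κ v).card : ℝ) ∂attachmentMeasure δ (t * m)
      = ∑ q ∈ potentialLeafless m s κ v, (attachmentMeasure δ (t * m)).real
          {g | DegOk δ M g ∧ ∀ a, target g (q.1 a) = q.2 a} := by
        simp only [leaflessTuples, Finset.card_filter, Nat.cast_sum, Nat.cast_ite, Nat.cast_one,
          Nat.cast_zero]
        rw [integral_finsetSum _ fun _ _ => .of_finite]
        refine Finset.sum_congr rfl fun q _ => ?_
        exact setIntegral_ite_one_zero _ _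
    _ ≤ ∑ q ∈ potentialLeafless m s κ v,
          (m * M) ^ s * ∏ p, f (Sum.elim (fun a => (q.1 a).divNat) q.2 p) :=
        Finset.sum_le_sum fun q hq =>
          attachmentMeasure_forall_target_le hM hm (Finset.mem_filter.1 hq).2.1 q.2
    _ ≤ ∑ q : (Fin s → Fin (t * m)) × (Fin s → Fin t) with
          Covering κ v (Sum.elim (fun a => (q.1 a).divNat) q.2),
          (m * M) ^ s * ∏ p, f (Sum.elim (fun a => (q.1 a).divNat) q.2 p) := by
        refine Finset.sum_le_sum_of_subset_of_nonneg
          (Finset.monotone_filter_right _ fun _ _ hq => hq.2) fun q _ _ => ?_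
        exact mul_nonneg (by positivity) (Finset.prod_nonneg fun p _ => (hf _).1)
    _ = (m * (m * M)) ^ s * ∑ w : Fin s ⊕ Fin s → Fin t with Covering κ v w, ∏ p, f (w p) := by
        rw [← Finset.mul_sum, Finset.sum_filter, Finset.sum_filter]
        have := sum_sumElim_divNat (m := m)
          fun w : Fin s ⊕ Fin s → Fin t => if Covering κ v w then ∏ p, f (w p) else 0
        rw [this, ← mul_assoc, ← mul_pow, mul_comm (m * M : ℝ)]
    _ ≤ _ := by
        simp_rw [← hfsq]
        exact mul_le_mul_of_nonneg_left (sum_covering_prod_le hcard hf hf0 v) (by positivity)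

/-! ### Tangled half-edges are rare -/

lemma card_tangledAt_le (g : Attachments (t * m)) (ℓ : ℕ) (v : Fin t) :
    (tangledAt (paGraph m t g) ℓ v).card ≤
      ∑ s ∈ Finset.range (ℓ + 1), (leaflessTuples g s 1 v).card * (2 * s) := by
  have hsub : tangledAt (paGraph m t g) ℓ v ⊆ (Finset.range (ℓ + 1)).biUnion fun s =>
      (leaflessTuples g s 1 v).biUnion fun q => (Finset.univ.image q.1) ×ˢ Finset.univ := by
    intro h hh
    obtain ⟨rfl, F, hF, hhF, hleaf⟩ := mem_tangledAt.1 hh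
    have hdeg : ({h} : Finset _).card ≤ (paGraph m t g).degIn F ((paGraph m t g).base h) :=
      Multigraph.card_le_degIn (by simp [hhF])
    obtain ⟨q, hq, hqF⟩ := exists_mem_leaflessTuples g hdeg hleaf
    simp only [Finset.mem_biUnion, Finset.mem_range, Finset.mem_product, Finset.mem_image,
      Finset.mem_univ, true_and, and_true]
    exact ⟨F.card, by omega, q, hq, hqF h.1 hhF⟩
  refine (Finset.card_le_card hsub).trans (Finset.card_biUnion_le.trans
    (Finset.sum_le_sum fun s _ => Finset.card_biUnion_le_card_mul _ _ _ fun q _ => ?_))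
  rw [Finset.card_product, Finset.card_univ, Fintype.card_bool, mul_comm]
  exact Nat.mul_le_mul_left 2 (Finset.card_image_le.trans_eq (Finset.card_fin s))

lemma one_le_sum_card_leaflessTuples (g : Attachments (t * m))
    (h : 2 < (tangledAt (paGraph m t g) ℓ v).card) :
    1 ≤ ∑ s ∈ Finset.range (3 * ℓ + 1), (leaflessTuples g s 3 v).card := by
  obtain ⟨S, hS, hcard⟩ := Finset.exists_subset_card_eq (Nat.succ_le_of_lt h)
  obtain ⟨F, hF, hv, hleaf⟩ := Multigraph.exists_leafless_of_tangled fun h hh =>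
    (mem_tangledAt.1 (hS hh)).symm
  rw [hcard] at hF hv
  obtain ⟨q, hq, -⟩ := exists_mem_leaflessTuples g hv hleaf
  exact (Nat.succ_le_of_lt (Finset.card_pos.2 ⟨q, hq⟩)).trans (Finset.single_le_sum
    (f := fun s => (leaflessTuples g s 3 v).card) (fun _ _ => Nat.zero_le _)
    (Finset.mem_range.2 (Nat.lt_succ_of_le hF)))

end Subgraphs

section MeanBounds

variable {δ : ℝ≥0} {m t s κ ℓ L : ℕ} {M : ℝ}

lemma one_le_sum_inv (ht : 0 < t) : 1 ≤ ∑ y : Fin t, 1 / ((y : ℝ) + 1) := by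
  refine le_of_eq_of_le ?_ (Finset.single_le_sum (f := fun y : Fin t => 1 / ((y : ℝ) + 1))
    (fun y _ => by positivity) (Finset.mem_univ ⟨0, ht⟩))
  simp

/-- The growth rate, per edge, of the expected number of leafless subgraphs with at most `L` edges
at a given vertex of `PA_t(m, δ)`, while the degrees are under control (`DegOk δ M`). -/
noncomputable def leaflessRate (m t L : ℕ) (M : ℝ) : ℝ :=
  m * (m * M) * (L + 1) ^ 2 * ∑ y : Fin t, 1 / ((y : ℝ) + 1)

section

variable (hm : 0 < m) (ht : 0 < t) (hM : 1 ≤ M) (L : ℕ)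
include hm hM

lemma one_le_mul_mul : 1 ≤ m * (m * M) := by
  have hm' : (1 : ℝ) ≤ m := by exact_mod_cast hm
  exact one_le_mul_of_one_le_of_one_le hm' (one_le_mul_of_one_le_of_one_le hm' hM)

lemma sum_inv_le_leaflessRate : ∑ y : Fin t, 1 / ((y : ℝ) + 1) ≤ leaflessRate m t L M := by
  refine le_mul_of_one_le_left (by positivity) ?_
  exact one_le_mul_of_one_le_of_one_le (one_le_mul_mul hm hM)
    (one_le_pow₀ (by linarith [(Nat.cast_nonneg L : (0 : ℝ) ≤ L)]))

include ht

lemma add_one_le_leaflessRate : L + 1 ≤ leaflessRate m t L M := by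
  have hL : (1 : ℝ) ≤ L + 1 := by linarith [(Nat.cast_nonneg L : (0 : ℝ) ≤ L)]
  calc (L + 1 : ℝ) ≤ (L + 1) ^ 2 := le_self_pow₀ hL two_ne_zero
    _ ≤ m * (m * M) * (L + 1) ^ 2 := le_mul_of_one_le_left (by positivity) (one_le_mul_mul hm hM)
    _ ≤ leaflessRate m t L M :=
      le_mul_of_one_le_right (by positivity) (one_le_sum_inv ht)

lemma one_le_leaflessRate : 1 ≤ leaflessRate m t L M :=
  le_trans (by simp) (add_one_le_leaflessRate hm ht hM L)

end

lemma setIntegral_card_leaflessTuples_le_pow (hm : 0 < m) (hM : 1 ≤ M) (hs : s ≤ L) (v : Fin t) :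
    ∫ g in {g | DegOk δ M g}, ((leaflessTuples g s κ v).card : ℝ) ∂attachmentMeasure δ (t * m) ≤
      leaflessRate m t L M ^ L * (1 / √((v : ℝ) + 1)) ^ κ := by
  refine (setIntegral_card_leaflessTuples_le (by positivity) hm v).trans ?_
  calc (m * (m * M)) ^ s * ((s + 1) ^ (2 * s) * (∑ y : Fin t, 1 / ((y : ℝ) + 1)) ^ s *
        (1 / √((v : ℝ) + 1)) ^ κ)
      = leaflessRate m t s M ^ s * (1 / √((v : ℝ) + 1)) ^ κ := by
        rw [leaflessRate, mul_pow _ (∑ y : Fin t, _) s, mul_pow _ ((s + 1 : ℝ) ^ 2) s, pow_mul]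
        ring
    _ ≤ leaflessRate m t L M ^ s * (1 / √((v : ℝ) + 1)) ^ κ := by
        unfold leaflessRate
        gcongr
    _ ≤ leaflessRate m t L M ^ L * (1 / √((v : ℝ) + 1)) ^ κ := by
        have := one_le_leaflessRate hm (Fin.pos v) hM L
        gcongr

lemma attachmentMeasure_tangledAt_le (hm : 0 < m) (hM : 1 ≤ M) (v : Fin t) :
    (attachmentMeasure δ (t * m)).real
        {g | DegOk δ M g ∧ 2 < (tangledAt (paGraph m t g) ℓ v).card} ≤
      leaflessRate m t (3 * ℓ) M ^ (3 * ℓ + 1) * (1 / √((v : ℝ) + 1)) ^ 3 := by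
  classical
  have hcount : (3 * ℓ + 1 : ℝ) ≤ leaflessRate m t (3 * ℓ) M := by
    exact_mod_cast add_one_le_leaflessRate hm (Fin.pos v) hM (3 * ℓ)
  calc _ = ∫ g in {g | DegOk δ M g},
          (if 2 < (tangledAt (paGraph m t g) ℓ v).card then (1 : ℝ) else 0)
            ∂attachmentMeasure δ (t * m) := (setIntegral_ite_one_zero _ _).symm
    _ ≤ ∫ g in {g | DegOk δ M g}, ∑ s ∈ Finset.range (3 * ℓ + 1),
          ((leaflessTuples g s 3 v).card : ℝ) ∂attachmentMeasure δ (t * m) := by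
        refine integral_mono .of_finite .of_finite fun g => ?_
        dsimp only
        split_ifs with h
        · exact_mod_cast one_le_sum_card_leaflessTuples g h
        · positivity
    _ = ∑ s ∈ Finset.range (3 * ℓ + 1), ∫ g in {g | DegOk δ M g},
          ((leaflessTuples g s 3 v).card : ℝ) ∂attachmentMeasure δ (t * m) :=
        integral_finsetSum _ fun _ _ => .of_finite
    _ ≤ ∑ s ∈ Finset.range (3 * ℓ + 1),
          leaflessRate m t (3 * ℓ) M ^ (3 * ℓ) * (1 / √((v : ℝ) + 1)) ^ 3 :=
        Finset.sum_le_sum fun _ hs => setIntegral_card_leaflessTuples_le_pow hm hM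
          (Nat.lt_succ_iff.1 (Finset.mem_range.1 hs)) v
    _ ≤ _ := by
        rw [Finset.sum_const, Finset.card_range, nsmul_eq_mul, ← mul_assoc, pow_succ' _ (3 * ℓ)]
        push_cast
        have := one_le_leaflessRate hm (Fin.pos v) hM (3 * ℓ)
        gcongr

lemma setIntegral_card_tangledAt_le (hm : 0 < m) (hM : 1 ≤ M) (v : Fin t) :
    ∫ g in {g | DegOk δ M g}, ((tangledAt (paGraph m t g) ℓ v).card : ℝ)
        ∂attachmentMeasure δ (t * m) ≤ leaflessRate m t (3 * ℓ) M ^ (3 * ℓ + 2) := by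
  set R := leaflessRate m t (3 * ℓ) M
  have hcount : (3 * ℓ + 1 : ℝ) ≤ R := by
    exact_mod_cast add_one_le_leaflessRate hm (Fin.pos v) hM (3 * ℓ)
  have hR : 1 ≤ R := one_le_leaflessRate hm (Fin.pos v) hM (3 * ℓ)
  have hv : 1 / √((v : ℝ) + 1) ≤ 1 :=
    div_le_one_of_le₀ (Real.one_le_sqrt.2 (by simp)) (Real.sqrt_nonneg _)
  calc _ ≤ ∫ g in {g | DegOk δ M g}, ∑ s ∈ Finset.range (ℓ + 1),
          ((leaflessTuples g s 1 v).card : ℝ) * (2 * s) ∂attachmentMeasure δ (t * m) :=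
        integral_mono .of_finite .of_finite fun g => by
          dsimp only
          exact_mod_cast card_tangledAt_le g ℓ v
    _ = ∑ s ∈ Finset.range (ℓ + 1), (∫ g in {g | DegOk δ M g},
          ((leaflessTuples g s 1 v).card : ℝ) ∂attachmentMeasure δ (t * m)) * (2 * s) := by
        rw [integral_finsetSum _ fun _ _ => .of_finite]
        simp_rw [integral_mul_const]
    _ ≤ ∑ _s ∈ Finset.range (ℓ + 1), R ^ (3 * ℓ) * R := by
        refine Finset.sum_le_sum fun _ hs => ?_
        have hs' := Nat.lt_succ_iff.1 (Finset.mem_range.1 hs)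
        have hsℓ := Nat.cast_le (α := ℝ).2 hs'
        refine mul_le_mul ((setIntegral_card_leaflessTuples_le_pow (L := 3 * ℓ) hm hM
          (by omega) v).trans ?_) (by linarith) (by positivity) (by positivity)
        rw [pow_one]
        exact mul_le_of_le_one_right (by positivity) hv
    _ = (ℓ + 1 : ℝ) * R ^ (3 * ℓ + 1) := by
        rw [Finset.sum_const, Finset.card_range, nsmul_eq_mul, pow_succ]
        push_cast
        ring
    _ ≤ R * R ^ (3 * ℓ + 1) := by
        gcongr
        linarith [(Nat.cast_nonneg ℓ : (0 : ℝ) ≤ ℓ)]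
    _ = R ^ (3 * ℓ + 2) := by ring

end MeanBounds

/-! ### The probability of a red vertex -/

section RedVertex

variable {δ : ℝ≥0} {m t k n C p r : ℕ} {M K : ℝ} {α : unitInterval}

lemma degBefore_le_degree_paGraph (hm : 0 < m) (g : Attachments (t * m)) (u : Fin t) :
    degBefore g (t * m) (m * u) ≤ (paGraph m t g).degree u := by
  have hlt : m * (u : ℕ) < t * m := by
    rw [mul_comm t]
    exact Nat.mul_lt_mul_of_pos_left u.isLt hm
  rw [← degree_attachmentGraph g ⟨m * u, hlt⟩]
  refine Finset.card_le_card fun e he => Multigraph.mem_halfEdges.2 ?_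
  change ((attachmentGraph g).base e).divNat = u
  rw [Multigraph.mem_halfEdges.1 he]
  exact Fin.ext (Nat.mul_div_cancel_left _ hm)

lemma le_degree_paGraph (g : Attachments (t * m)) (u : Fin t) : m ≤ (paGraph m t g).degree u := by
  have hown (c : Fin m) : (finProdFinEquiv (u, c), false) ∈ (paGraph m t g).halfEdges u := by
    refine Multigraph.mem_halfEdges.2 ((paGraph_ends_false g _).trans ?_)
    exact congrArg Prod.fst (finProdFinEquiv.symm_apply_apply (u, c))
  simpa [Multigraph.degree] using Finset.card_le_card_of_injOn (s := Finset.univ) _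
    (fun c _ => hown c) fun c _ c' _ h => by simpa using h

/-- The vertices `0, …, C - 1` of a graph with vertices `0, …, t - 1`. -/
def earlyVertices (t C : ℕ) : Finset (Fin t) :=
  Finset.univ.filter fun u => (u : ℕ) < C

lemma mem_earlyVertices {u : Fin t} : u ∈ earlyVertices t C ↔ (u : ℕ) < C := by
  simp [earlyVertices]

lemma card_earlyVertices_le (t C : ℕ) : (earlyVertices t C).card ≤ C :=
  (Finset.card_le_card_of_injOn (t := Finset.range C) (fun u : Fin t => (u : ℕ))
    (fun _ hu => Finset.mem_coe.2 (Finset.mem_range.2 (mem_earlyVertices.1 hu)))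
    fun _ _ _ _ h => Fin.ext h).trans_eq (Finset.card_range C)

lemma attachmentMeasure_degBefore_lt_le (hm : 0 < m) (hK : 0 < K) {u : Fin t} (hu : (u : ℕ) < C) :
    (attachmentMeasure δ (t * m)).real {g | degBefore g (t * m) (m * u) < K} ≤
      (K + δ) * ((C : ℝ) / t) ^ degExponent δ := by
  have ht : (0 : ℝ) < t := by exact_mod_cast Fin.pos u
  have hle : m * (u : ℕ) ≤ t * m := by
    rw [mul_comm t]
    exact Nat.mul_le_mul_left m u.isLt.le
  have hratio : ((m * u : ℕ) + 1 : ℝ) / ((t * m : ℕ) + 1) ≤ C / t := by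
    have hC : ((m * u : ℕ) + 1 : ℝ) ≤ C * m := by
      exact_mod_cast (by nlinarith : m * u + 1 ≤ C * m)
    rw [div_le_div_iff₀ (by positivity) ht]
    push_cast at hC ⊢
    nlinarith [(Nat.cast_nonneg C : (0 : ℝ) ≤ C)]
  have hdeg (g : Attachments (t * m)) : (0 : ℝ) < degBefore g (t * m) (m * u) + δ := by
    have := one_le_degBefore g (t * m) (m * u)
    positivity
  have hmarkov := mul_meas_ge_le_integral_of_nonneg (μ := attachmentMeasure δ (t * m))
    (f := fun g => 1 / (degBefore g (t * m) (m * u) + δ : ℝ))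
    (.of_forall fun g => (one_div_pos.2 (hdeg g)).le) .of_finite (1 / (K + δ))
  rw [one_div_mul_eq_div, div_le_iff₀' (by positivity)] at hmarkov
  refine (measureReal_mono (fun g hg => ?_) (measure_ne_top _ _)).trans (hmarkov.trans ?_)
  · exact one_div_le_one_div_of_le (hdeg g) (by gcongr; exact le_of_lt hg)
  · refine mul_le_mul_of_nonneg_left ((integral_inv_degBefore_le hle).trans ?_) (by positivity)
    exact Real.rpow_le_rpow (by positivity) hratio (degExponent_pos δ).le

lemma attachmentMeasure_exists_degBefore_lt_le (hm : 0 < m) (hK : 0 < K) :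
    (attachmentMeasure δ (t * m)).real
        {g | ∃ u ∈ earlyVertices t C, degBefore g (t * m) (m * u) < K} ≤
      C * ((K + δ) * ((C : ℝ) / t) ^ degExponent δ) := by
  rw [show {g : Attachments (t * m) | ∃ u ∈ earlyVertices t C, degBefore g (t * m) (m * u) < K} =
    ⋃ u ∈ earlyVertices t C, {g | degBefore g (t * m) (m * u) < K} by ext; simp]
  refine (measureReal_biUnion_finset_le _ _).trans ((Finset.sum_le_card_nsmul _ _ _ fun u hu =>
    attachmentMeasure_degBefore_lt_le hm hK (mem_earlyVertices.1 hu)).trans ?_)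
  rw [nsmul_eq_mul]
  gcongr
  exact card_earlyVertices_le t C

lemma inv_sqrt_pow_three_le (hC : 0 < C) {v : ℕ} (hv : C ≤ v) :
    (1 / √((v : ℝ) + 1)) ^ 3 ≤ 1 / ((v : ℝ) + 1) * (1 / √C) := by
  have : (0 : ℝ) < C := by exact_mod_cast hC
  have hv' : (C : ℝ) ≤ v + 1 := by exact_mod_cast hv.trans v.le_succ
  rw [pow_succ, div_pow, Real.sq_sqrt (by positivity), one_pow]
  gcongr

lemma attachmentMeasure_exists_tangledAt_le (hm : 0 < m) (hC : 0 < C) (hM : 1 ≤ M) (ℓ : ℕ) :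
    (attachmentMeasure δ (t * m)).real {g | DegOk δ M g ∧
        ∃ v ∉ earlyVertices t C, 2 < (tangledAt (paGraph m t g) ℓ v).card} ≤
      leaflessRate m t (3 * ℓ) M ^ (3 * ℓ + 2) / √C := by
  set R := leaflessRate m t (3 * ℓ) M
  have hsum : ∑ v : Fin t, 1 / ((v : ℝ) + 1) ≤ R := sum_inv_le_leaflessRate hm hM _
  have hR : 0 ≤ R := le_trans (by positivity) hsum
  rw [show {g : Attachments (t * m) | DegOk δ M g ∧
      ∃ v ∉ earlyVertices t C, 2 < (tangledAt (paGraph m t g) ℓ v).card} =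
    ⋃ v ∈ (earlyVertices t C)ᶜ,
      {g | DegOk δ M g ∧ 2 < (tangledAt (paGraph m t g) ℓ v).card} by ext; simp]
  calc _ ≤ ∑ v ∈ (earlyVertices t C)ᶜ, (attachmentMeasure δ (t * m)).real
          {g | DegOk δ M g ∧ 2 < (tangledAt (paGraph m t g) ℓ v).card} :=
        measureReal_biUnion_finset_le _ _
    _ ≤ ∑ v ∈ (earlyVertices t C)ᶜ, R ^ (3 * ℓ + 1) * (1 / ((v : ℝ) + 1) * (1 / √C)) := by
        refine Finset.sum_le_sum fun v hv => (attachmentMeasure_tangledAt_le hm hM v).trans ?_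
        rw [Finset.mem_compl, mem_earlyVertices, not_lt] at hv
        exact mul_le_mul_of_nonneg_left (inv_sqrt_pow_three_le hC hv) (by positivity)
    _ ≤ ∑ v : Fin t, R ^ (3 * ℓ + 1) * (1 / ((v : ℝ) + 1) * (1 / √C)) :=
        Finset.sum_le_univ_sum_of_nonneg fun v => by positivity
    _ = R ^ (3 * ℓ + 1) * (∑ v : Fin t, 1 / ((v : ℝ) + 1)) / √C := by
        rw [← Finset.mul_sum, ← Finset.sum_mul]
        ring
    _ ≤ R ^ (3 * ℓ + 1) * R / √C := by gcongr
    _ = R ^ (3 * ℓ + 2) / √C := by ring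

lemma setIntegral_sum_card_tangledAt_le (hm : 0 < m) (hM : 1 ≤ M) (ℓ : ℕ) {b : ℝ} (hb : 0 ≤ b) :
    ∫ g in {g | DegOk δ M g},
        ∑ u ∈ earlyVertices t C, ((tangledAt (paGraph m t g) ℓ u).card : ℝ) * b
        ∂attachmentMeasure δ (t * m) ≤
      C * (leaflessRate m t (3 * ℓ) M ^ (3 * ℓ + 2) * b) := by
  have hR : 0 ≤ leaflessRate m t (3 * ℓ) M := by
    unfold leaflessRate
    positivity
  rw [integral_finsetSum _ fun _ _ => .of_finite]
  simp_rw [integral_mul_const]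
  refine (Finset.sum_le_card_nsmul _ _ _ fun u _ => mul_le_mul_of_nonneg_right
    (setIntegral_card_tangledAt_le hm hM u) hb).trans ?_
  rw [nsmul_eq_mul]
  gcongr
  exact card_earlyVertices_le t C

lemma protocolLaw_paGraph_exists_red_le (hm : 0 < m) (hK : 0 < K) (hr : 2 ≤ r)
    (hα : ∀ j, (majorityMap r)^[j] α ∈ Set.Icc (0 : ℝ) (1 / 2))
    (hodd : ∀ D, m ≤ D → ∃ s, r ≤ s ∧ pollSize k D = 2 * s + 1) {g : Attachments (t * m)}
    (hearly : ∀ u ∈ earlyVertices t C, K ≤ degBefore g (t * m) (m * u))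
    (hlate : ∀ v ∉ earlyVertices t C, (tangledAt (paGraph m t g) (2 * n + 1) v).card ≤ 2) :
    (protocolLaw (paGraph m t g) k α).real
        {ω | ∃ v, colourAt (paGraph m t g) ω.1 ω.2 (n + 1) v = .red} ≤
      2 * (t * m) * (majorityMap r)^[n] α +
        ∑ u ∈ earlyVertices t C, (tangledAt (paGraph m t g) (2 * n + 1) u).card * (k / K) := by
  refine (protocolLaw_exists_red_le hr hα (fun v => hodd _ (le_degree_paGraph g v)) hlate).trans ?_
  rw [Fintype.card_fin, Nat.cast_mul]
  gcongr with u hu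
  exact (hearly u hu).trans (by exact_mod_cast degBefore_le_degree_paGraph hm g u)

lemma integral_le_measureReal_add {Ω : Type*} [Finite Ω] [MeasurableSpace Ω]
    [DiscreteMeasurableSpace Ω] {μ : Measure Ω} [IsFiniteMeasure μ] {f h : Ω → ℝ} {B S : Set Ω}
    (hf : ∀ ω, f ω ≤ 1) (hB : ∀ ω ∉ B, f ω ≤ h ω) (hh : ∀ ω, 0 ≤ h ω) (hS : Bᶜ ⊆ S) :
    ∫ ω, f ω ∂μ ≤ μ.real B + ∫ ω in S, h ω ∂μ := by
  rw [← integral_add_compl (.of_discrete : MeasurableSet B) .of_finite]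
  refine add_le_add ?_ ?_
  · refine (integral_mono .of_finite (.of_finite : Integrable (fun _ => (1 : ℝ)) _) hf).trans_eq ?_
    simp
  · refine (setIntegral_mono_on Integrable.of_finite.integrableOn
      Integrable.of_finite.integrableOn .of_discrete hB).trans ?_
    exact setIntegral_mono_set Integrable.of_finite.integrableOn (.of_forall hh) hS.eventuallyLE

lemma integral_exists_red_le (hm : 0 < m) (hC : 0 < C) (hK : 0 < K)
    (hr : 2 ≤ r) (hM : 1 ≤ M) (hα : ∀ j, (majorityMap r)^[j] α ∈ Set.Icc (0 : ℝ) (1 / 2))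
    (hodd : ∀ D, m ≤ D → ∃ s, r ≤ s ∧ pollSize k D = 2 * s + 1) :
    ∫ g, (protocolLaw (paGraph m t g) k α).real
        {ω | ∃ v, colourAt (paGraph m t g) ω.1 ω.2 (n + 1) v = .red}
        ∂attachmentMeasure δ (t * m) ≤
      (attachmentMeasure δ (t * m)).real {g | ¬ DegOk δ M g} +
      C * ((K + δ) * ((C : ℝ) / t) ^ degExponent δ) +
      leaflessRate m t (3 * (2 * n + 1)) M ^ (3 * (2 * n + 1) + 2) / √C +
      2 * (t * m) * (majorityMap r)^[n] α +
      C * (leaflessRate m t (3 * (2 * n + 1)) M ^ (3 * (2 * n + 1) + 2) * (k / K)) := by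
  set ℓ := 2 * n + 1
  set wild : Set (Attachments (t * m)) := {g | ¬ DegOk δ M g}
  set sparse : Set (Attachments (t * m)) :=
    {g | ∃ u ∈ earlyVertices t C, degBefore g (t * m) (m * u) < K}
  set tangled : Set (Attachments (t * m)) :=
    {g | DegOk δ M g ∧ ∃ v ∉ earlyVertices t C, 2 < (tangledAt (paGraph m t g) ℓ v).card}
  have hx : 0 ≤ 2 * (t * m) * (majorityMap r)^[n] α := mul_nonneg (by positivity) (hα n).1
  have hbad : (attachmentMeasure δ (t * m)).real (wild ∪ sparse ∪ tangled) ≤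
      (attachmentMeasure δ (t * m)).real wild + C * ((K + δ) * ((C : ℝ) / t) ^ degExponent δ) +
        leaflessRate m t (3 * ℓ) M ^ (3 * ℓ + 2) / √C :=
    (measureReal_union_le _ _).trans (add_le_add ((measureReal_union_le _ _).trans
      (add_le_add_right (attachmentMeasure_exists_degBefore_lt_le hm hK) _))
      (attachmentMeasure_exists_tangledAt_le hm hC hM ℓ))
  have hgood : ∫ g in {g | DegOk δ M g}, (2 * (t * m) * (majorityMap r)^[n] α +
        ∑ u ∈ earlyVertices t C, ((tangledAt (paGraph m t g) ℓ u).card : ℝ) * (k / K))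
        ∂attachmentMeasure δ (t * m) ≤ 2 * (t * m) * (majorityMap r)^[n] α +
      C * (leaflessRate m t (3 * ℓ) M ^ (3 * ℓ + 2) * (k / K)) := by
    rw [integral_add .of_finite .of_finite, setIntegral_const, smul_eq_mul]
    exact add_le_add (mul_le_of_le_one_left hx measureReal_le_one)
      (setIntegral_sum_card_tangledAt_le hm hM ℓ (by positivity))
  refine (integral_le_measureReal_add (fun g => measureReal_le_one) (fun g hg => ?_)
    (fun g => add_nonneg hx (by positivity)) fun g hg => ?_).trans
    ((add_le_add hbad hgood).trans_eq (add_assoc _ _ _).symm)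
  · simp only [wild, sparse, tangled, Set.mem_union, Set.mem_ofPred_eq, not_or, not_and,
      not_exists, not_not, not_lt] at hg
    exact protocolLaw_paGraph_exists_red_le hm hK hr hα hodd hg.1.2 (hg.2 hg.1.1)
  · by_contra hok
    exact hg (Or.inl (Or.inl hok))

lemma measurableSet_exists_red (g : Attachments (t * m)) (T : ℕ) :
    MeasurableSet {ω : (Fin t → Colour) × (ℕ × Fin t → Finset (Fin (t * m) × Bool)) |
      ∃ v, colourAt (paGraph m t g) ω.1 ω.2 T v = .red} := by
  have h : Measurable fun ω : (Fin t → Colour) × (ℕ × Fin t → Finset (Fin (t * m) × Bool)) =>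
      colourAt (paGraph m t g) ω.1 ω.2 T :=
    measurable_from_prod_countable_right fun c => measurable_colourAt c T
  exact h (.of_discrete (s := {c : Fin t → Colour | ∃ v, c v = .red}))

lemma experimentLaw_real_exists_red (m : ℕ) (δ : ℝ≥0) (k : ℕ) (α : unitInterval) (t T : ℕ) :
    (experimentLaw m δ k α t).real {ω | ∃ v, Outcome.colour ω T v = .red} =
      ∫ g, (protocolLaw (paGraph m t g) k α).real
        {ω | ∃ v, colourAt (paGraph m t g) ω.1 ω.2 T v = .red}
        ∂attachmentMeasure (δ / m) (t * m) := by
  have hmeas : MeasurableSet {ω : Outcome m t | ∃ v, Outcome.colour ω T v = .red} :=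
    measurableSet_setOfPred.2 (measurable_from_prod_countable_right fun g =>
      measurableSet_setOfPred.1 (measurableSet_exists_red g T))
  have : IsMarkovKernel (Kernel.ofFunOfCountable fun g : Attachments (t * m) =>
      protocolLaw (paGraph m t g) k α) :=
    ⟨fun g => inferInstanceAs (IsProbabilityMeasure (protocolLaw (paGraph m t g) k α))⟩
  rw [measureReal_def, experimentLaw, Measure.compProd_apply hmeas]
  exact (integral_toReal (Measurable.of_discrete).aemeasurable
    (.of_forall fun g => measure_lt_top _ _)).symm

end RedVertex

section Polls

variable {m k d : ℕ}

lemma Colour.eq_blue_of_ne_red {c : Colour} (h : c ≠ .red) : c = .blue := by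
  cases c with
  | red => exact absurd rfl h
  | blue => rfl

lemma colourAt_eq_blue_of_le {V E : Type} {G : Multigraph V E} {c : V → Colour}
    {polls : ℕ × V → Finset (E × Bool)} {T τ : ℕ} (hT : ∀ v, colourAt G c polls T v = .blue)
    (h : T ≤ τ) (v : V) : colourAt G c polls τ v = .blue := by
  induction τ, h using Nat.le_induction generalizing v with
  | base => exact hT v
  | succ τ _ ih => simp [colourAt, ih]

lemma odd_of_eq_ite_min (hm : 0 < m) (hk : Odd k)
    (hd : d = if Odd m then min m k else min (m - 1) k) : Odd d := by
  split_ifs at hd with h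
  · exact hd ▸ min_rec' Odd h hk
  · exact hd ▸ min_rec' Odd (Nat.Even.sub_odd hm (Nat.not_odd_iff_even.1 h) odd_one) hk

lemma exists_pollSize_eq {r : ℕ} (hm : 5 ≤ m) (hk : Odd k)
    (hd : 2 * r + 1 = if Odd m then min m k else min (m - 1) k) {D : ℕ} (hD : m ≤ D) :
    ∃ s, r ≤ s ∧ pollSize k D = 2 * s + 1 := by
  obtain ⟨s, hs⟩ : Odd (pollSize k D) := by
    unfold pollSize
    split_ifs with h h'
    · exact hk
    · exact h'
    · exact Nat.Even.sub_odd (by omega) (Nat.not_odd_iff_even.1 h') odd_one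
  refine ⟨s, ?_, hs⟩
  unfold pollSize at hs
  grind

end Polls

/-! ### Asymptotics -/

section PolynomialBounds

variable {t C K W η x : ℝ}

lemma ceil_rpow_le (ht : 1 ≤ t) (hη : 0 ≤ η) : (⌈t ^ η⌉₊ : ℝ) ≤ 2 * t ^ η := by
  have hceil := (Nat.ceil_lt_add_one (Real.rpow_nonneg (by linarith : 0 ≤ t) η)).le
  linarith [Real.one_le_rpow ht hη]

lemma early_term_le {δ : ℝ} (hδ : 0 ≤ δ) (ht : 1 ≤ t) (hη : 0 ≤ η) (hη' : 40 * η ≤ 1)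
    (hC : 0 ≤ C) (hCt : C ≤ 2 * t ^ (4 * η)) :
    C * ((t ^ (12 * η) + δ) * (C / t) ^ (40 * η)) ≤ 4 * (1 + δ) * t ^ (-η) := by
  have ht0 : 0 < t := by linarith
  have hK : t ^ (12 * η) + δ ≤ (1 + δ) * t ^ (12 * η) := by
    nlinarith [Real.one_le_rpow ht (by positivity : 0 ≤ 12 * η)]
  have hratio : C / t ≤ 2 * t ^ (4 * η - 1) := by
    rw [Real.rpow_sub_one ht0.ne', mul_div_assoc']
    gcongr
  have hpow : (C / t) ^ (40 * η) ≤ 2 * t ^ ((4 * η - 1) * (40 * η)) := by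
    calc (C / t) ^ (40 * η) ≤ (2 * t ^ (4 * η - 1)) ^ (40 * η) := by gcongr
      _ = 2 ^ (40 * η) * t ^ ((4 * η - 1) * (40 * η)) := by
        rw [Real.mul_rpow zero_le_two (by positivity), ← Real.rpow_mul ht0.le]
      _ ≤ 2 * t ^ ((4 * η - 1) * (40 * η)) := by
        gcongr
        exact Real.rpow_le_self_of_one_le one_le_two hη'
  calc C * ((t ^ (12 * η) + δ) * (C / t) ^ (40 * η))
      ≤ 2 * t ^ (4 * η) * ((1 + δ) * t ^ (12 * η) * (2 * t ^ ((4 * η - 1) * (40 * η)))) := by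
        gcongr
    _ = 4 * (1 + δ) * (t ^ (4 * η) * t ^ (12 * η) * t ^ ((4 * η - 1) * (40 * η))) := by ring
    _ = 4 * (1 + δ) * t ^ (4 * η + 12 * η + (4 * η - 1) * (40 * η)) := by
        rw [← Real.rpow_add ht0, ← Real.rpow_add ht0]
    _ ≤ 4 * (1 + δ) * t ^ (-η) := by
        gcongr
        nlinarith

lemma late_term_le (ht : 0 < t) (hC : t ^ (4 * η) ≤ C) (hW : W ≤ t ^ η) :
    W / √C ≤ t ^ (-η) := by
  have hsqrt : t ^ (2 * η) ≤ √C := by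
    refine Real.le_sqrt_of_sq_le (le_of_eq_of_le ?_ hC)
    rw [← Real.rpow_mul_natCast ht.le]
    congr 1
    push_cast
    ring
  calc W / √C ≤ t ^ η / t ^ (2 * η) := by gcongr
    _ = t ^ (-η) := by
        rw [← Real.rpow_sub ht]
        congr 1
        ring

lemma treeLike_term_le {m : ℝ} (hm : 0 ≤ m) (ht : 1 ≤ t) (hη : η ≤ 1) (hx : x ≤ t ^ (-2 : ℝ)) :
    2 * (t * m) * x ≤ 2 * m * t ^ (-η) := by
  have ht0 : 0 < t := by linarith
  calc 2 * (t * m) * x ≤ 2 * (t * m) * t ^ (-2 : ℝ) := by gcongr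
    _ = 2 * m * t ^ (1 + -2 : ℝ) := by
        rw [Real.rpow_add ht0, Real.rpow_one]
        ring
    _ ≤ 2 * m * t ^ (-η) := by
        gcongr
        linarith

lemma poll_term_le {k : ℝ} (hk : 0 ≤ k) (ht : 1 ≤ t) (hη : 0 ≤ η) (hC : C ≤ 2 * t ^ (4 * η))
    (hW0 : 0 ≤ W) (hW : W ≤ t ^ η) :
    C * (W * (k / t ^ (12 * η))) ≤ 2 * k * t ^ (-η) := by
  have ht0 : 0 < t := by linarith
  calc C * (W * (k / t ^ (12 * η))) ≤ 2 * t ^ (4 * η) * (t ^ η * (k / t ^ (12 * η))) := by gcongr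
    _ = 2 * k * (t ^ (4 * η) * t ^ η * t ^ (-(12 * η))) := by
        rw [Real.rpow_neg ht0.le]
        ring
    _ = 2 * k * t ^ (4 * η + η + -(12 * η)) := by
        rw [← Real.rpow_add ht0, ← Real.rpow_add ht0]
    _ ≤ 2 * k * t ^ (-η) := by
        gcongr
        linarith

end PolynomialBounds

section RedVertexAsymptotics

variable {δ : ℝ≥0} {m t k n r : ℕ} {α : unitInterval}

lemma attachmentMeasure_not_degOk_le_rpow (ht : 1 ≤ t) {η : ℝ} (hη : η ≤ 1) :
    (attachmentMeasure δ (t * m)).real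
        {g | ¬ DegOk δ (degFactor δ ⌈2 * Real.log t⌉₊) g} ≤ m ^ 2 * (t : ℝ) ^ (-η) := by
  have ht0 : (0 : ℝ) < t := by exact_mod_cast ht
  have hexp : Real.exp (-2 * ⌈2 * Real.log t⌉₊) ≤ (t : ℝ) ^ (-4 : ℝ) := by
    rw [Real.rpow_def_of_pos ht0, Real.exp_le_exp]
    linarith [Nat.le_ceil (2 * Real.log t)]
  refine (attachmentMeasure_not_degOk_le _).trans ?_
  calc ((t * m : ℕ) : ℝ) ^ 2 * Real.exp (-2 * ⌈2 * Real.log t⌉₊)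
      ≤ ((t * m : ℕ) : ℝ) ^ 2 * (t : ℝ) ^ (-4 : ℝ) := by gcongr
    _ = m ^ 2 * (t : ℝ) ^ (2 + -4 : ℝ) := by
        rw [Real.rpow_add ht0, Real.rpow_two]
        push_cast
        ring
    _ ≤ m ^ 2 * (t : ℝ) ^ (-η) := by
        gcongr
        · exact_mod_cast ht
        · linarith

lemma one_le_degFactor (δ : ℝ≥0) (p : ℕ) : 1 ≤ degFactor δ p := by
  have : (0 : ℝ) ≤ δ + p := by positivity
  exact one_le_mul_of_one_le_of_one_le (by linarith) (Real.one_le_exp zero_le_two)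

lemma experimentLaw_exists_red_le_rpow (hm : 0 < m) (ht : 1 ≤ t) (hr : 2 ≤ r)
    (hα : ∀ j, (majorityMap r)^[j] α ∈ Set.Icc (0 : ℝ) (1 / 2))
    (hodd : ∀ D, m ≤ D → ∃ s, r ≤ s ∧ pollSize k D = 2 * s + 1) {η : ℝ}
    (hη : 40 * η = degExponent (δ / m)) (hx : (majorityMap r)^[n] α ≤ (t : ℝ) ^ (-2 : ℝ))
    (hW : leaflessRate m t (3 * (2 * n + 1)) (degFactor (δ / m) ⌈2 * Real.log t⌉₊) ^
      (3 * (2 * n + 1) + 2) ≤ (t : ℝ) ^ η) :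
    (experimentLaw m δ k α t).real {ω | ∃ v, Outcome.colour ω (n + 1) v = .red} ≤
      (m ^ 2 + 4 * (1 + (δ / m : ℝ≥0)) + 1 + 2 * m + 2 * k) * (t : ℝ) ^ (-η) := by
  have ht' : (1 : ℝ) ≤ t := by exact_mod_cast ht
  have ht0 : (0 : ℝ) < t := by linarith
  have hη0 : 0 ≤ η := by linarith [degExponent_pos (δ / m)]
  have hη1 : 40 * η ≤ 1 := hη.trans_le (degExponent_le_one _)
  set C := ⌈(t : ℝ) ^ (4 * η)⌉₊
  have hC : (t : ℝ) ^ (4 * η) ≤ C := Nat.le_ceil _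
  have hC' : (C : ℝ) ≤ 2 * (t : ℝ) ^ (4 * η) := ceil_rpow_le ht' (by positivity)
  rw [experimentLaw_real_exists_red]
  refine (integral_exists_red_le (C := C) hm (Nat.ceil_pos.2 (by positivity))
    (Real.rpow_pos_of_pos ht0 (12 * η)) hr (one_le_degFactor (δ / m) ⌈2 * Real.log t⌉₊) hα
    hodd).trans ?_
  rw [← hη]
  simp only [add_mul]
  refine add_le_add (add_le_add (add_le_add (add_le_add ?_ ?_) ?_) ?_) ?_
  · exact attachmentMeasure_not_degOk_le_rpow ht (by linarith)
  · simpa only [add_mul] using early_term_le (NNReal.coe_nonneg _) ht' hη0 hη1 C.cast_nonneg hC'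
  · simpa only [one_mul] using late_term_le ht0 hC hW
  · exact treeLike_term_le m.cast_nonneg ht' (by linarith) hx
  · exact poll_term_le k.cast_nonneg ht' hη0 hC' (by unfold leaflessRate degFactor; positivity) hW

end RedVertexAsymptotics

section Growth

lemma sum_inv_le_one_add_log (t : ℕ) : ∑ y : Fin t, 1 / ((y : ℝ) + 1) ≤ 1 + Real.log t := by
  have h := harmonic_le_one_add_log t
  rw [harmonic] at h
  push_cast at h
  rw [Fin.sum_univ_eq_sum_range fun y => 1 / ((y : ℝ) + 1)]
  simpa only [one_div] using h

lemma eventually_add_mul_le_sq (a b : ℝ) : ∀ᶠ y : ℝ in atTop, a + b * y ≤ y ^ 2 := by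
  filter_upwards [eventually_ge_atTop 1, eventually_ge_atTop (|a| + |b|)] with y hy hab
  nlinarith [le_abs_self a, le_abs_self b, abs_nonneg a, abs_nonneg b]

lemma tendsto_log_natCast_atTop : Tendsto (fun t : ℕ => Real.log t) atTop atTop :=
  Real.tendsto_log_atTop.comp tendsto_natCast_atTop_atTop

lemma eventually_leaflessRate_le_log_pow (m : ℕ) (δ : ℝ≥0) :
    ∀ᶠ t : ℕ in atTop, ∀ L : ℕ, (L + 1 : ℝ) ≤ Real.log t →
      leaflessRate m t L (degFactor δ ⌈2 * Real.log t⌉₊) ≤ Real.log t ^ 6 := by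
  have hlog := tendsto_log_natCast_atTop
  filter_upwards [hlog.eventually_ge_atTop 0, hlog.eventually (eventually_add_mul_le_sq 1 1),
    hlog.eventually (eventually_add_mul_le_sq (m * (m * (2 * (2 + δ) * Real.exp 2)))
      (m * (m * (4 * Real.exp 2))))] with t ht hsum hdeg L hL
  set y := Real.log t
  have hfactor : m * (m * degFactor δ ⌈2 * y⌉₊) ≤ y ^ 2 := by
    refine le_trans ?_ hdeg
    calc m * (m * degFactor δ ⌈2 * y⌉₊) ≤ m * (m * (2 * (1 + δ + (2 * y + 1)) * Real.exp 2)) := by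
          unfold degFactor
          gcongr
          exact (Nat.ceil_lt_add_one (by positivity)).le
      _ = m * (m * (2 * (2 + δ) * Real.exp 2)) + m * (m * (4 * Real.exp 2)) * y := by ring
  calc leaflessRate m t L (degFactor δ ⌈2 * y⌉₊) ≤ y ^ 2 * y ^ 2 * y ^ 2 := by
        unfold leaflessRate
        gcongr
        linarith [sum_inv_le_one_add_log t]
    _ = y ^ 6 := by ring

lemma eventually_le_mul_of_isLittleO_id {f : ℝ → ℝ} (hf : f =o[atTop] (id : ℝ → ℝ)) {c : ℝ}
    (hc : 0 < c) : ∀ᶠ y in atTop, f y ≤ c * y := by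
  filter_upwards [hf.bound hc, eventually_ge_atTop 0] with y hy hy0
  simpa only [id, Real.norm_of_nonneg hy0] using (Real.le_norm_self _).trans hy

lemma eventually_leaflessRate_pow_le_rpow (m : ℕ) (δ : ℝ≥0) (B : ℝ) {η : ℝ} (hη : 0 < η) :
    ∀ᶠ t : ℕ in atTop, ∀ L : ℕ, (L + 2 : ℝ) ≤ B * Real.log (Real.log t) →
      leaflessRate m t L (degFactor δ ⌈2 * Real.log t⌉₊) ^ (L + 2) ≤ (t : ℝ) ^ η := by
  have hlog := tendsto_log_natCast_atTop
  have hlin := eventually_le_mul_of_isLittleO_id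
    (Real.isLittleO_log_id_atTop.const_mul_left B) one_pos
  have hsq := eventually_le_mul_of_isLittleO_id
    ((Real.isLittleO_pow_log_id_atTop (n := 2)).const_mul_left (6 * B)) hη
  filter_upwards [eventually_gt_atTop 0, hlog.eventually_ge_atTop 1, hlog.eventually hlin,
    hlog.eventually hsq, eventually_leaflessRate_le_log_pow m δ] with t ht hy hlin hsq hrate L hL
  have hlog_nonneg : 0 ≤ Real.log (Real.log t) := Real.log_nonneg hy
  calc leaflessRate m t L (degFactor δ ⌈2 * Real.log t⌉₊) ^ (L + 2)
      ≤ (Real.log t ^ 6) ^ (L + 2) := by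
        refine pow_le_pow_left₀ (by unfold leaflessRate degFactor; positivity) ?_ _
        exact hrate L (by linarith)
    _ = Real.exp ((L + 2) * (6 * Real.log (Real.log t))) := by
        rw [← Real.exp_log (show 0 < Real.log t ^ 6 by positivity), ← Real.exp_nat_mul,
          Real.log_pow]
        push_cast
        ring_nf
    _ ≤ Real.exp (Real.log t * η) := by
        rw [Real.exp_le_exp]
        nlinarith
    _ = (t : ℝ) ^ η := (Real.rpow_def_of_pos (by exact_mod_cast ht) η).symm

lemma eventually_add_ceil_logb_le {r a : ℝ} (hr : 1 < r) (ha : 1 < a) (c : ℝ) :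
    ∀ᶠ t : ℕ in atTop, c + ⌈Real.logb r (2 * Real.log t)⌉₊ ≤ a * Real.logb r (Real.log t) := by
  have hlog := tendsto_log_natCast_atTop
  filter_upwards [hlog.eventually_ge_atTop 1, ((Real.tendsto_logb_atTop hr).comp hlog
    ).eventually_ge_atTop ((c + 1 + Real.logb r 2) / (a - 1))] with t ht hbig
  have hsplit : Real.logb r (2 * Real.log t) = Real.logb r 2 + Real.logb r (Real.log t) :=
    Real.logb_mul two_ne_zero (by linarith)
  have hceil := Nat.ceil_lt_add_one (Real.logb_nonneg hr (by linarith : 1 ≤ 2 * Real.log t))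
  rw [Function.comp_apply, div_le_iff₀ (by linarith)] at hbig
  linarith

lemma eventually_add_ceil_logb_le_time {d r ε : ℝ} (hd : 1 < d) (hr : 1 < r) (hε : 0 < ε)
    (c : ℝ) :
    ∀ᶠ t : ℕ in atTop, c + ⌈Real.logb r (2 * Real.log t)⌉₊ ≤
      (1 + ε) / Real.logb d r * Real.logb d (Real.logb d t) := by
  have hlogd : 0 < Real.log d := Real.log_pos hd
  filter_upwards [tendsto_log_natCast_atTop.eventually_gt_atTop 0, eventually_add_ceil_logb_le hr
    (by linarith : 1 < 1 + ε) (c + (1 + ε) * Real.logb r (Real.log d))] with t ht hbig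
  have htime : (1 + ε) / Real.logb d r * Real.logb d (Real.logb d t) =
      (1 + ε) * (Real.logb r (Real.log t) - Real.logb r (Real.log d)) := by
    rw [← Real.logb_div ht.ne' hlogd.ne', Real.log_div_log, div_eq_mul_inv, Real.inv_logb,
      mul_assoc, Real.mul_logb (by positivity) (by linarith) (by linarith)]
  linarith

end Growth

section Limit

lemma tendsto_measure_one_of_compl_subset {Ω : ℕ → Type*} [∀ t, MeasurableSpace (Ω t)]
    {μ : ∀ t, Measure (Ω t)} [∀ t, IsProbabilityMeasure (μ t)] {A B : ∀ t, Set (Ω t)}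
    (h : ∀ᶠ t in atTop, (A t)ᶜ ⊆ B t)
    (hB : Tendsto (fun t => (μ t).real (B t)) atTop (𝓝 0)) :
    Tendsto (fun t => μ t (A t)) atTop (𝓝 1) := by
  have hlow : Tendsto (fun t => 1 - (μ t).real (B t)) atTop (𝓝 1) := by
    simpa only [sub_zero] using hB.const_sub 1
  refine (ENNReal.tendsto_toReal_iff (fun t => measure_ne_top _ _) ENNReal.one_ne_top).1 ?_
  refine tendsto_of_tendsto_of_tendsto_of_le_of_le' hlow tendsto_const_nhds ?_
    (.of_forall fun t => measureReal_le_one)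
  filter_upwards [h] with t ht
  have huniv : (μ t).real (A t ∪ B t) = 1 := by
    rw [show A t ∪ B t = Set.univ from Set.compl_subset_iff_union.1 ht, probReal_univ]
  change 1 - (μ t).real (B t) ≤ (μ t).real (A t)
  linarith [measureReal_union_le (μ := μ t) (A t) (B t)]

lemma exists_tendsto_experimentLaw_exists_red {m k r : ℕ} {α : unitInterval} {a : ℝ} (hm : 0 < m)
    (hr : 2 ≤ r) (ha : a ∈ lowerBounds (majorityFixedPoints r)) (hα : (α : ℝ) ∈ Set.Ico 0 a)
    (hodd : ∀ D, m ≤ D → ∃ s, r ≤ s ∧ pollSize k D = 2 * s + 1) (δ : ℝ≥0) :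
    ∃ h : ℕ, Tendsto (fun t : ℕ => (experimentLaw m δ k α t).real
      {ω | ∃ v, Outcome.colour ω (h + ⌈Real.logb r (2 * Real.log t)⌉₊ + 1) v = .red})
      atTop (𝓝 0) := by
  have hr' : (1 : ℝ) < r := by exact_mod_cast hr
  obtain ⟨h, hdecay⟩ := exists_iterate_majorityMap_le_exp hr ha hα
  refine ⟨h, ?_⟩
  have hη : 0 < degExponent (δ / m) / 40 := div_pos (degExponent_pos _) (by norm_num)
  set η := degExponent (δ / m) / 40
  have hlim : Tendsto (fun t : ℕ => (m ^ 2 + 4 * (1 + (δ / m : ℝ≥0)) + 1 + 2 * m + 2 * k) *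
      (t : ℝ) ^ (-η)) atTop (𝓝 0) := by
    simpa only [mul_zero, Function.comp_def] using
      ((tendsto_rpow_neg_atTop hη).comp tendsto_natCast_atTop_atTop).const_mul _
  refine squeeze_zero' (.of_forall fun t => measureReal_nonneg) ?_ hlim
  filter_upwards [eventually_ge_atTop 1, tendsto_log_natCast_atTop.eventually_gt_atTop 0,
    eventually_leaflessRate_pow_le_rpow m (δ / m) (12 / Real.log r) hη,
    eventually_add_ceil_logb_le hr' one_lt_two (h + 1)] with t ht hlog hrate hceil
  set i := ⌈Real.logb r (2 * Real.log t)⌉₊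
  refine experimentLaw_exists_red_le_rpow hm ht hr (fun j => ?_) hodd
    (mul_div_cancel₀ _ (by norm_num)) ?_ (hrate _ ?_)
  · have hj := iterate_majorityMap_mem_Ico hr ha hα j
    exact ⟨hj.1, hj.2.le.trans (le_half_of_mem_lowerBounds hr ha)⟩
  · have hpow : 2 * Real.log t ≤ (r : ℝ) ^ i := by
      rw [← Real.rpow_natCast, ← Real.logb_le_iff_le_rpow hr' (by positivity)]
      exact Nat.le_ceil _
    refine (hdecay i).trans ?_
    rw [Real.rpow_def_of_pos (by exact_mod_cast ht), Real.exp_le_exp]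
    linarith
  · rw [Real.logb] at hceil
    push_cast
    calc (3 * (2 * (h + i) + 1) + 2 : ℝ) ≤ 6 * (h + 1 + i) := by linarith
      _ ≤ 6 * (2 * (Real.log (Real.log t) / Real.log r)) := by gcongr
      _ = 12 / Real.log r * Real.log (Real.log t) := by ring

end Limit

end PrefAttach

theorem theorem1 (m k d : ℕ) (hm : 5 ≤ m) (hk : 5 ≤ k) (hk_odd : Odd k)
    (hd : d = if Odd m then min m k else min (m - 1) k)
    (δ : ℝ≥0) (αstar α : unitInterval)
    (hαstar : IsLeast {x : unitInterval | 0 < x ∧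
      (binomial (d - 1) x).real {j : ℕ | ((d : ℝ) - 1) / 2 ≤ (j : ℝ)} = (x : ℝ)} αstar)
    (hα : α < αstar) (ε : ℝ) (hε : 0 < ε) :
    Tendsto
      (fun t : ℕ => PrefAttach.experimentLaw m δ k α t
        {ω | ∀ τ : ℕ,
          (1 + ε) / Real.logb d (((d : ℝ) - 1) / 2) * Real.logb d (Real.logb d t) ≤ (τ : ℝ) →
            ∀ v : Fin t, PrefAttach.Outcome.colour ω τ v = PrefAttach.Colour.blue})
      atTop (𝓝 1) := by
  open PrefAttach in
  obtain ⟨r, rfl⟩ := odd_of_eq_ite_min (by omega) hk_odd hd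
  have hr : 2 ≤ r := by grind
  have hhalf : (((2 * r + 1 : ℕ) : ℝ) - 1) / 2 = r := by push_cast; ring
  simp only [hhalf, Nat.cast_le, Nat.add_sub_cancel, binomial_real_setOf_le] at hαstar ⊢
  have hlb : (αstar : ℝ) ∈ lowerBounds (majorityFixedPoints r) := fun x hx =>
    hαstar.2 (show (⟨x, hx.1.le, hx.2.1⟩ : unitInterval) ∈ _ from ⟨hx.1, hx.2.2⟩)
  obtain ⟨h, hred⟩ := exists_tendsto_experimentLaw_exists_red (by omega) hr hlb ⟨α.2.1, hα⟩
    (fun _ => exists_pollSize_eq hm hk_odd hd) δ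
  refine tendsto_measure_one_of_compl_subset ?_ hred
  filter_upwards [eventually_add_ceil_logb_le_time (d := (2 * r + 1 : ℕ)) (r := r)
    (by exact_mod_cast (by omega : 1 < 2 * r + 1)) (by exact_mod_cast hr) hε (h + 1)] with t ht
  refine Set.compl_subset_comm.1 fun ω hω τ hτ v => ?_
  have hblue (v : Fin t) :
      Outcome.colour ω (h + ⌈Real.logb r (2 * Real.log t)⌉₊ + 1) v = .blue :=
    Colour.eq_blue_of_ne_red fun hv => hω ⟨v, hv⟩
  refine colourAt_eq_blue_of_le hblue ?_ v
  rw [← Nat.cast_le (α := ℝ)]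
  push_cast
  linarith
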